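/- **Setting.** There are $K\ge 1$ arms and $T>K$ rounds. Arm $i$ has a reward distribution $\mathcal V_i$ supported in $[0,1]$ with mean $\mu_i$, and a delay distribution $\mathcal D_i$ on $\mathbb N$ with CDF $\tau_i$. In round $t=1,\dots,T$ the learner pulls an arm $I_t$ on the basis of the past; given the past and $I_t=i$, a pair $(C_t,D_t)\sim\mathcal V_i\otimes\mathcal D_i$ is generated. At time $t$ the learner only knows, of the pulls $s\le t$, the values $X_{s,u}=C_s\mathbf 1\{D_s\le u\}$ with $u\le t-s$. The expected regret is $\bar R_T=T\max_i\mu_i-\mathbb E\sum_{t=1}^T C_t$. **Assumption.** There are $0<c\le 1$, $\bar\mu>0$ and $\alpha\ge\underline\alpha>0$ such that $\min_i\mu_i>\bar\mu$ and $c\,m^{-\alpha}\le|1-\tau_i(m)|\le m^{-\alpha}$ for all arms $i$ and all integers $m\ge1$. **Algorithm (Adapt-PatientBandits, inputs $c,\underline\alpha,\bar\mu,T,K$; the value of $\alpha$ is not an input).** Write $T_i(t)=\#\{s\le t: I_s=i\}$. The first $2K$ rounds pull each arm twice. After each time $t$ with $2K\le t<T$, let $j$ be an arm with the largest $T_j(t)$,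 let $\bar T_t=T_j(t)$, $D=\lfloor\bar T_t/2\rfloor$, $d=\lfloor(c/2)^{1/\underline\alpha}D\rfloor$, and, for $\delta\in\{d,D\}$, $$\bar m_{t,\delta}=\frac1{T_j(t-\delta)}\sum_{s=1}^{t-\delta}X_{s,\delta}\mathbf 1\{I_s=j\}.$$ Put $$\hat\alpha_t=\min\Big(-\frac{\log(\bar m_{t,D}-\bar m_{t,d})}{\log\bar T_t},\frac12\Big),\qquad \bar\alpha_t=\max\Big(\hat\alpha_t-\frac{\log\big(2^4\sqrt{\log(2KT^3)}/(c\bar\mu)\big)}{\log\bar T_t},\,0\Big),$$ where $-\log x=+\infty$ for $x\le0$. Round $t+1$ pulls an arm $i$ that maximises $$\mathrm{UCB}_i(t)=\frac1{T_i(t)}\sum_{u=1}^tX_{u,t-u}\mathbf 1\{I_u=i\}+\Big(\frac{2\log(2KT^3)}{T_i(t)}\Big)^{1/2}+2\,T_i(t)^{-(\bar\alpha_t\wedge1/2)}.$$ The order of the first $2K$ pulls and the choice among ties are arbitrary (if $T<2K$, the first phase is cut off at round $T$). **Theorem.** Under the assumption, the expected regret of Adapt-PatientBandits satisfies $$\bar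 R_T\le 8^{17}\Big(\frac1{c\bar\mu}\Big)^4\Big(\frac2c\Big)^{4(\alpha\wedge1/2)/\underline\alpha}\log(2T)^{13/2}\,T\Big(\frac KT\Big)^{\alpha\wedge1/2},$$ and hence also $$\bar R_T\le 8^{17}\Big(\frac1{c\bar\mu}\Big)^4\Big(\frac2c\Big)^{4(\alpha\wedge1/2)/\underline\alpha}\log(2T)^{13/2}\,K^{\alpha}\,T^{1-\alpha\wedge1/2},$$ that is, $\bar R_T=\widetilde{\mathcal O}(K^\alpha T^{1-\alpha\wedge1/2})$. -/

import Mathlib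

open MeasureTheory ProbabilityTheory
open scoped BigOperators

noncomputable section

/-- An instance of the stochastic delayed bandit problem with `K` arms: every arm has a reward
distribution supported in `[0, 1]` and a delay distribution on `ℕ`. -/
structure DelayedBandit (K : ℕ) where
  reward : Fin K → Measure ℝ
  delay : Fin K → Measure ℕ
  reward_prob : ∀ i, IsProbabilityMeasure (reward i)
  delay_prob : ∀ i, IsProbabilityMeasure (delay i)
  reward_support : ∀ i, ∀ᵐ x ∂(reward i), x ∈ Set.Icc (0 : ℝ) 1

namespace DelayedBandit

variable {K : ℕ}

/-- The mean `μ i` of the reward distribution of arm `i`. -/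
def mean (B : DelayedBandit K) (i : Fin K) : ℝ := ∫ x, x ∂(B.reward i)

/-- The cumulative distribution function `τ i` of the delay of arm `i`. -/
def tau (B : DelayedBandit K) (i : Fin K) (m : ℕ) : ℝ := (B.delay i).real (Set.Iic m)

/-- Two-sided polynomial tails of the delays with exponent `α`, means bounded below, and a known
lower bound `αlow` on the exponent. -/
structure TwoSidedTails (B : DelayedBandit K) (α αlow c μlow : ℝ) : Prop where
  c_pos : 0 < c
  c_le_one : c ≤ 1
  μlow_pos : 0 < μlow
  μlow_lt_mean : ∀ i, μlow < B.mean i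
  tail_lower : ∀ i, ∀ m : ℕ, 1 ≤ m → c * (m : ℝ) ^ (-α) ≤ |1 - B.tau i m|
  tail_upper : ∀ i, ∀ m : ℕ, 1 ≤ m → |1 - B.tau i m| ≤ (m : ℝ) ^ (-α)
  αlow_pos : 0 < αlow
  αlow_le : αlow ≤ α

/-- The interaction of a learner with the instance `B` during the rounds `1, …, T`, on a
probability space `(Ω, P)`: `I t` is the arm pulled in round `t`, and `C t`, `D t` are the reward
and the delay generated in round `t`. The σ-algebra `ℱ t` contains the past up to the end of
round `t` (and possibly extra randomness of the learner). The arm of round `t + 1` is chosen on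
the basis of the past, and given the past and `I (t + 1) = i`, the pair `(C (t + 1), D (t + 1))`
has the law `reward i ⊗ delay i`. -/
structure IsRun (B : DelayedBandit K) {Ω : Type*} [mΩ : MeasurableSpace Ω] (P : Measure Ω) (T : ℕ)
    (ℱ : Filtration ℕ mΩ) (I : ℕ → Ω → Fin K) (C : ℕ → Ω → ℝ) (D : ℕ → Ω → ℕ) : Prop where
  measurable_arm : ∀ t < T, Measurable[ℱ t] (I (t + 1))
  measurable_reward : ∀ t < T, Measurable[ℱ (t + 1)] (C (t + 1))
  measurable_delay : ∀ t < T, Measurable[ℱ (t + 1)] (D (t + 1))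
  law : ∀ t < T, ∀ i : Fin K, ∀ A : Set Ω, MeasurableSet[ℱ t] A →
    ∀ S : Set (ℝ × ℕ), MeasurableSet S →
      P (A ∩ {ω | I (t + 1) ω = i} ∩ {ω | (C (t + 1) ω, D (t + 1) ω) ∈ S})
        = P (A ∩ {ω | I (t + 1) ω = i}) * ((B.reward i).prod (B.delay i)) S

/-- The expected regret `T μ* - 𝔼 ∑_{t=1}^T C_t`, where `μ*` is the largest mean. -/
def regret (B : DelayedBandit K) {Ω : Type*} [MeasurableSpace Ω] (P : Measure Ω) (T : ℕ)
    (C : ℕ → Ω → ℝ) : ℝ :=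
  (T : ℝ) * (⨆ i, B.mean i) - ∫ ω, ∑ t ∈ Finset.Icc 1 T, C t ω ∂P

end DelayedBandit

/-- What the learner sees, `u` rounds after its pull in round `s`, of the reward of that pull:
`X s u = C s * 1{D s ≤ u}`. -/
def observedReward (C : ℕ → ℝ) (D : ℕ → ℕ) (s u : ℕ) : ℝ := if D s ≤ u then C s else 0

namespace AdaptPatientBandits

variable {K : ℕ}

/-! Throughout, `I s` is the arm pulled in round `s ≥ 1` and `X s u` is the observed reward of
round `s` after `u` further rounds. -/

/-- `T_i(t)`, the number of pulls of arm `i` in the rounds `1, …, t`. -/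
def pulls (I : ℕ → Fin K) (i : Fin K) (t : ℕ) : ℕ := ((Finset.Icc 1 t).filter (fun s => I s = i)).card

/-- The mean estimator of arm `i` at time `t`. -/
def muHat (I : ℕ → Fin K) (X : ℕ → ℕ → ℝ) (i : Fin K) (t : ℕ) : ℝ :=
  (1 / (pulls I i t : ℝ)) * ∑ u ∈ Finset.Icc 1 t, if I u = i then X u (t - u) else 0

/-- `UCB_i(t)` computed with the exponent `a`. -/
def ucb (T : ℕ) (I : ℕ → Fin K) (X : ℕ → ℕ → ℝ) (a : ℝ) (i : Fin K) (t : ℕ) : ℝ :=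
  muHat I X i t
    + Real.sqrt (2 * Real.log (2 * (K : ℝ) * (T : ℝ) ^ 3) / (pulls I i t : ℝ))
    + 2 * (pulls I i t : ℝ) ^ (-(min a (1 / 2)))

/-- The sample mean, after waiting `d` rounds, of the pulls of arm `j` in the rounds
`1, …, t - d`. -/
def waitMean (I : ℕ → Fin K) (X : ℕ → ℕ → ℝ) (j : Fin K) (t d : ℕ) : ℝ :=
  (1 / (pulls I j (t - d) : ℝ)) * ∑ s ∈ Finset.Icc 1 (t - d), if I s = j then X s d else 0

/-- The longer waiting time, half the number of pulls of arm `j`, rounded down. -/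
def longWait (I : ℕ → Fin K) (j : Fin K) (t : ℕ) : ℕ := pulls I j t / 2

/-- The shorter waiting time `⌊(c / 2) ^ (1 / αlow) * longWait⌋`. -/
def shortWait (c αlow : ℝ) (I : ℕ → Fin K) (j : Fin K) (t : ℕ) : ℕ :=
  ⌊(c / 2) ^ (1 / αlow) * (longWait I j t : ℝ)⌋₊

/-- The estimator of `α` at time `t` from the pulls of arm `j`. The number `-log x` is read as
`+∞` for `x ≤ 0`, so that the minimum with `1 / 2` is then `1 / 2`. -/
def alphaHat (c αlow : ℝ) (I : ℕ → Fin K) (X : ℕ → ℕ → ℝ) (j : Fin K) (t : ℕ) : ℝ :=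
  let x := waitMean I X j t (longWait I j t) - waitMean I X j t (shortWait c αlow I j t)
  if x ≤ 0 then 1 / 2 else min (-(Real.log x / Real.log (pulls I j t : ℝ))) (1 / 2)

/-- The lower confidence bound on `α` at time `t` from the pulls of arm `j`. -/
def alphaBar (c αlow μlow : ℝ) (T : ℕ) (I : ℕ → Fin K) (X : ℕ → ℕ → ℝ) (j : Fin K) (t : ℕ) : ℝ :=
  max (alphaHat c αlow I X j t
    - Real.log (2 ^ 4 * Real.sqrt (Real.log (2 * (K : ℝ) * (T : ℝ) ^ 3)) / (c * μlow))
        / Real.log (pulls I j t : ℝ)) 0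

/-- The arms `I 1, …, I T` are pulled according to Adapt-PatientBandits with the inputs
`c, αlow, μlow, T, K` on the observations `X`: the first `2 K` rounds pull each arm twice, and
every later round `t + 1 ≤ T` pulls an arm maximising the UCB of time `t`, computed with the
exponent `alphaBar` of a most pulled arm `j`. Ties, and the order of the first `2 K` pulls, are
arbitrary. -/
def Follows (c αlow μlow : ℝ) (T : ℕ) (I : ℕ → Fin K) (X : ℕ → ℕ → ℝ) : Prop :=
  (2 * K ≤ T → ∀ i, pulls I i (2 * K) = 2) ∧
  (T < 2 * K → ∀ i, pulls I i T ≤ 2) ∧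
  ∀ t, 2 * K ≤ t → t < T →
    ∃ j : Fin K, (∀ i, pulls I i t ≤ pulls I j t) ∧
      ∀ i, ucb T I X (alphaBar c αlow μlow T I X j t) i t
        ≤ ucb T I X (alphaBar c αlow μlow T I X j t) (I (t + 1)) t

end AdaptPatientBandits

end

/-!
The regret of a run is the expected sum of the gaps `max μ - μ (I t)` of the pulled arms, so it
suffices to bound that sum on an event of probability at least `1 - 1 / T`.

*Concentration.* For every arm, every round and every waiting rule that the algorithm uses, the
observed rewards of the pulls minus their conditional means form a martingale with increments in an
interval of length `1`. Hoeffding's lemma gives an exponential supermartingale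
(`lintegral_expDeviation_le_one`), a Chernoff bound for each possible number of pulls and a union
bound give the event `Concentrated` (`measure_not_concentrated_le`). The rest is deterministic.

*Missing rewards.* Write `a = min α (1 / 2)`. Since the pulls of an arm happen in different rounds,
`n` pulls miss a mass of at most `∑ m < n, min 1 (m ^ (-a)) ≤ 2 n ^ (1 - a)` of their rewards
(`sum_tail_le`). Hence the upper confidence bound is optimistic as soon as `alphaBar ≤ a`.

*The exponent.* The two waiting means of the most pulled arm `j`, with `n` pulls, differ by
`μ j * (τ D - τ d)` up to the noise `√(confLog / n)`. The ratio of the waiting times is such that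
`D ^ (-α) ≤ τ D - τ d ≤ d ^ (-α)`, so this difference determines `n ^ (-a)` up to a factor. Hence
`alphaBar ≤ a` (`Concentrated.alphaBar_le`), while `n ^ (-alphaBar)` exceeds `n ^ (-a)` by at most
the factor `112 * confLog * (2 / c) ^ (a / αlow) / (c * μlow)`
(`Concentrated.rpow_neg_alphaBar_le`). The argument needs `d ≥ 1`; when `d = 0`, every arm has at
most `3 * (2 / c) ^ (1 / αlow)` pulls, and the bound on the gap of the round exceeds `1`.

*Summation.* Thus each round costs a constant times `n ^ (-a)`, where `n` counts the earlier pulls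
of its arm (`Concentrated.mean_sub_mean_le`). Such a term is at most `4` times the
increment of the potential `∑ i, (pulls i) ^ (1 - a)`, which is at most `K ^ a * T ^ (1 - a)` by
concavity.
-/

/-! ### Power sums -/

lemma mul_rpow_neg_le_rpow_sub_rpow {a x : ℝ} (ha0 : 0 ≤ a) (ha1 : a ≤ 1) (hx : 1 ≤ x) :
    (1 - a) * x ^ (-a) ≤ x ^ (1 - a) - (x - 1) ^ (1 - a) := by
  have hx0 : 0 < x := by linarith
  have hx1 : 1 / x ≤ 1 := by rw [div_le_one hx0]; exact hx
  have h := rpow_one_add_le_one_add_mul_self (s := -(1 / x)) (by linarith) (p := 1 - a)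
    (by linarith) (by linarith)
  have e1 : x - 1 = x * (1 + -(1 / x)) := by field_simp; ring
  have e2 : x ^ (1 - a) = x * x ^ (-a) := by
    rw [sub_eq_add_neg, Real.rpow_add hx0, Real.rpow_one]
  rw [e1, Real.mul_rpow hx0.le (by linarith)]
  have h2 := mul_le_mul_of_nonneg_left h (Real.rpow_nonneg hx0.le (1 - a))
  have e3 : x ^ (1 - a) * (1 + (1 - a) * -(1 / x)) = x ^ (1 - a) - (1 - a) * x ^ (-a) := by
    rw [e2]; field_simp; ring
  linarith

lemma rpow_neg_le_four_mul_increment {a : ℝ} (ha0 : 0 ≤ a) (ha1 : a ≤ 1 / 2) {n : ℕ} (hn : 1 ≤ n) :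
    (n : ℝ) ^ (-a) ≤ 4 * (((n + 1 : ℕ) : ℝ) ^ (1 - a) - (n : ℝ) ^ (1 - a)) := by
  have hn' : (1 : ℝ) ≤ n := by exact_mod_cast hn
  have h := mul_rpow_neg_le_rpow_sub_rpow ha0 (by linarith) (x := (n : ℝ) + 1) (by linarith)
  have h1 : ((n : ℝ) + 1) ^ (-a) ≥ (2 * (n : ℝ)) ^ (-a) :=
    Real.rpow_le_rpow_of_nonpos (by linarith) (by linarith) (by linarith)
  have h2 : (1 / 2 : ℝ) ≤ 2 ^ (-a) := by
    rw [show (1 / 2 : ℝ) = 2 ^ (-1 : ℝ) by rw [Real.rpow_neg_one]; norm_num]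
    exact Real.rpow_le_rpow_of_exponent_le (by norm_num) (by linarith)
  rw [Real.mul_rpow (by norm_num) (by linarith)] at h1
  have h3 : 0 ≤ (n : ℝ) ^ (-a) := by positivity
  have h4 := mul_le_mul_of_nonneg_right h2 h3
  have h5 : 0 ≤ ((n : ℝ) + 1) ^ (-a) := by positivity
  push_cast
  rw [add_sub_cancel_right] at h
  nlinarith

/-- A tail bounded by `m ^ (-a)` with `a ≤ 1 / 2` has partial sums at most `2 n ^ (1 - a)`. The
constant `2` is the one in the bonus of the algorithm, so it must not be larger. -/
lemma sum_range_le_two_mul_rpow {a : ℝ} (ha0 : 0 ≤ a) (ha1 : a ≤ 1 / 2) {F : ℕ → ℝ} (h0 : F 0 ≤ 1)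
    (hF : ∀ m : ℕ, 1 ≤ m → F m ≤ (m : ℝ) ^ (-a)) {n : ℕ} (hn : 1 ≤ n) :
    ∑ m ∈ Finset.range n, F m ≤ 2 * (n : ℝ) ^ (1 - a) := by
  have key : ∀ k : ℕ, 1 ≤ k →
      (1 - a) * ∑ m ∈ Finset.range (k + 1), F m ≤ (k : ℝ) ^ (1 - a) + (1 - 2 * a) := by
    intro k hk
    induction k, hk using Nat.le_induction with
    | base =>
      have := hF 1 le_rfl
      simp [Finset.sum_range_succ] at this ⊢
      nlinarith
    | succ k hk ih =>
      rw [Finset.sum_range_succ]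
      have h1 := hF (k + 1) (by omega)
      have h2 := mul_rpow_neg_le_rpow_sub_rpow ha0 (by linarith) (x := ((k + 1 : ℕ) : ℝ))
        (by push_cast; linarith [(Nat.cast_nonneg k : (0 : ℝ) ≤ k)])
      have h3 : ((k + 1 : ℕ) : ℝ) - 1 = k := by push_cast; ring
      rw [h3] at h2
      have h4 := mul_le_mul_of_nonneg_left h1 (show 0 ≤ 1 - a by linarith)
      linarith
  obtain ⟨k, rfl⟩ : ∃ k, n = k + 1 := ⟨n - 1, by omega⟩
  have hone : (1 : ℝ) ≤ ((k + 1 : ℕ) : ℝ) ^ (1 - a) :=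
    Real.one_le_rpow (by push_cast; linarith [(Nat.cast_nonneg k : (0 : ℝ) ≤ k)]) (by linarith)
  rcases Nat.eq_zero_or_pos k with rfl | hk
  · simp; linarith
  · have h1 := key k hk
    have h2 : (k : ℝ) ^ (1 - a) ≤ ((k + 1 : ℕ) : ℝ) ^ (1 - a) :=
      Real.rpow_le_rpow (by positivity) (by push_cast; linarith) (by linarith)
    have h3 : (1 - a) * ∑ m ∈ Finset.range (k + 1), F m
        ≤ (1 - a) * (2 * ((k + 1 : ℕ) : ℝ) ^ (1 - a)) := by nlinarith
    exact le_of_mul_le_mul_left h3 (by linarith)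

lemma sum_le_sum_range_card {F : ℕ → ℝ} (hF : Antitone F) (S : Finset ℕ) :
    ∑ m ∈ S, F m ≤ ∑ m ∈ Finset.range S.card, F m := by
  induction S using Finset.induction_on_max with
  | empty => simp
  | insert b s hb ih =>
    have hnot : b ∉ s := fun h => lt_irrefl _ (hb b h)
    rw [Finset.sum_insert hnot, Finset.card_insert_of_notMem hnot, Finset.sum_range_succ]
    have hc : s.card ≤ b := by
      have : s ⊆ Finset.range b := fun x hx => Finset.mem_range.2 (hb x hx)
      simpa using Finset.card_le_card this
    linarith [hF hc]

namespace AdaptPatientBandits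

variable {K : ℕ}

/-! ### Counting pulls -/

lemma pulls_zero (I : ℕ → Fin K) (i : Fin K) : pulls I i 0 = 0 := by simp [pulls]

lemma pulls_succ (I : ℕ → Fin K) (i : Fin K) (t : ℕ) :
    pulls I i (t + 1) = pulls I i t + if I (t + 1) = i then 1 else 0 := by
  unfold pulls
  rw [← Finset.insert_Icc_right_eq_Icc_add_one (by omega), Finset.filter_insert]
  split_ifs
  · rw [Finset.card_insert_of_notMem (by simp)]
  · rfl

lemma pulls_mono (I : ℕ → Fin K) (i : Fin K) : Monotone (pulls I i) :=
  monotone_nat_of_le_succ fun t => by rw [pulls_succ]; omega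

lemma pulls_le (I : ℕ → Fin K) (i : Fin K) (t : ℕ) : pulls I i t ≤ t := by
  induction t with
  | zero => simp [pulls_zero]
  | succ t ih => rw [pulls_succ]; split_ifs <;> omega

lemma pulls_le_pulls_sub_add (I : ℕ → Fin K) (i : Fin K) (t δ : ℕ) :
    pulls I i t ≤ pulls I i (t - δ) + δ := by
  induction δ with
  | zero => simp
  | succ δ ih =>
    rcases Nat.eq_zero_or_pos (t - δ) with h | h
    · have : t - (δ + 1) = t - δ := by omega
      rw [this]; omega
    · obtain ⟨k, hk⟩ : ∃ k, t - δ = k + 1 := ⟨t - δ - 1, by omega⟩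
      have h2 : t - (δ + 1) = k := by omega
      rw [hk, pulls_succ] at ih
      rw [h2]
      split_ifs at ih <;> omega

lemma sum_pulls (I : ℕ → Fin K) (t : ℕ) : ∑ i, pulls I i t = t := by
  induction t with
  | zero => simp [pulls_zero]
  | succ t ih => simp [pulls_succ, Finset.sum_add_distrib, ih]

lemma sum_ite_const (I : ℕ → Fin K) (i : Fin K) (t : ℕ) (x : ℝ) :
    ∑ s ∈ Finset.Icc 1 t, (if I s = i then x else 0) = pulls I i t * x := by
  rw [← Finset.sum_filter, Finset.sum_const, nsmul_eq_mul, pulls]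

/-- The pulls of one arm happen in different rounds, so the missing mass at time `t` is largest
when they are the last ones. -/
lemma sum_tail_le {a : ℝ} (ha0 : 0 ≤ a) (ha1 : a ≤ 1 / 2) {F : ℕ → ℝ} (hanti : Antitone F)
    (h0 : F 0 ≤ 1) (hF : ∀ m : ℕ, 1 ≤ m → F m ≤ (m : ℝ) ^ (-a)) (I : ℕ → Fin K) (i : Fin K)
    {t : ℕ} (ht : 1 ≤ pulls I i t) :
    ∑ s ∈ Finset.Icc 1 t, (if I s = i then F (t - s) else 0) ≤ 2 * (pulls I i t : ℝ) ^ (1 - a) := by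
  rw [← Finset.sum_filter]
  have hinj : Set.InjOn (fun s => t - s) ((Finset.Icc 1 t).filter (fun s => I s = i) : Set ℕ) := by
    intro x hx y hy hxy
    simp only [Finset.coe_filter, Finset.mem_Icc, Set.mem_ofPred_eq] at hx hy hxy
    omega
  rw [← Finset.sum_image (f := F) hinj]
  refine (sum_le_sum_range_card hanti _).trans ?_
  rw [Finset.card_image_of_injOn hinj]
  exact sum_range_le_two_mul_rpow ha0 ha1 h0 hF ht

/-- The sum over the rounds of `n ^ (-a)`, where `n` counts the earlier pulls of the arm of the
round, is controlled by the potential `∑ i, (pulls i) ^ (1 - a)`. -/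
lemma sum_pulls_rpow_neg_le {a : ℝ} (ha0 : 0 ≤ a) (ha1 : a ≤ 1 / 2) (I : ℕ → Fin K) {t₀ T : ℕ}
    (h : t₀ ≤ T) (hp : ∀ i, 1 ≤ pulls I i t₀) :
    ∑ t ∈ Finset.Ico t₀ T, (pulls I (I (t + 1)) t : ℝ) ^ (-a)
      ≤ 4 * ∑ i, (pulls I i T : ℝ) ^ (1 - a) := by
  induction T, h using Nat.le_induction with
  | base => simp; positivity
  | succ T hT ih =>
    rw [Finset.sum_Ico_succ_top hT]
    have h1 := rpow_neg_le_four_mul_increment ha0 ha1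
      ((hp (I (T + 1))).trans (pulls_mono I (I (T + 1)) hT))
    have h2 : ∑ i, ((pulls I i (T + 1) : ℝ) ^ (1 - a) - (pulls I i T : ℝ) ^ (1 - a))
        = ((pulls I (I (T + 1)) T + 1 : ℕ) : ℝ) ^ (1 - a)
          - (pulls I (I (T + 1)) T : ℝ) ^ (1 - a) := by
      rw [Finset.sum_eq_single (I (T + 1))]
      · rw [pulls_succ, if_pos rfl]
      · intro b _ hb
        rw [pulls_succ, if_neg (Ne.symm hb)]; simp
      · simp
    rw [Finset.sum_sub_distrib] at h2
    linarith

lemma sum_pulls_rpow_le {a : ℝ} (ha0 : 0 ≤ a) (ha1 : a ≤ 1) (hK : 1 ≤ K) (I : ℕ → Fin K) (T : ℕ) :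
    ∑ i, (pulls I i T : ℝ) ^ (1 - a) ≤ (K : ℝ) ^ a * (T : ℝ) ^ (1 - a) := by
  have hK' : (0 : ℝ) < K := by exact_mod_cast hK
  have hc := (Real.concaveOn_rpow (p := 1 - a) (by linarith) (by linarith)).le_map_sum
    (t := Finset.univ) (w := fun _ : Fin K => 1 / (K : ℝ)) (p := fun i => (pulls I i T : ℝ))
    (fun _ _ => by positivity) (by simp; field_simp) (fun i _ => by simp)
  simp only [smul_eq_mul, ← Finset.mul_sum] at hc
  rw [show (∑ i, (pulls I i T : ℝ)) = T by exact_mod_cast sum_pulls I T,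
    Real.mul_rpow (by positivity) (by positivity)] at hc
  have e : (1 / (K : ℝ)) ^ (1 - a) = (K : ℝ) ^ a / K := by
    rw [one_div, Real.inv_rpow hK'.le, ← Real.rpow_neg hK'.le, ← Real.rpow_sub_one hK'.ne']
    congr 1; ring
  rw [e, div_mul_eq_mul_div, div_mul_eq_mul_div, one_mul] at hc
  exact (div_le_div_iff_of_pos_right hK').1 hc

end AdaptPatientBandits

/-! ### Means and delay tails -/

namespace DelayedBandit

variable {K : ℕ}

lemma mean_mem_Icc (B : DelayedBandit K) (i : Fin K) : B.mean i ∈ Set.Icc (0 : ℝ) 1 := by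
  have := B.reward_prob i
  have hs := B.reward_support i
  refine ⟨integral_nonneg_of_ae (hs.mono fun x hx => hx.1), ?_⟩
  have h := integral_mono_of_nonneg (μ := B.reward i) (f := fun x => x) (g := fun _ => (1 : ℝ))
    (hs.mono fun x hx => hx.1) (integrable_const _) (hs.mono fun x hx => hx.2)
  simpa [mean] using h

lemma tau_mem_Icc (B : DelayedBandit K) (i : Fin K) (m : ℕ) : B.tau i m ∈ Set.Icc (0 : ℝ) 1 := by
  have := B.delay_prob i
  exact ⟨measureReal_nonneg, measureReal_le_one⟩

lemma tail_antitone (B : DelayedBandit K) (i : Fin K) : Antitone fun m => 1 - B.tau i m := by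
  have := B.delay_prob i
  intro m n hmn
  have : B.tau i m ≤ B.tau i n := measureReal_mono (Set.Iic_subset_Iic.2 hmn)
  change 1 - B.tau i n ≤ 1 - B.tau i m
  linarith

namespace TwoSidedTails

variable {B : DelayedBandit K} {α αlow c μlow : ℝ}

lemma tail_le (h : B.TwoSidedTails α αlow c μlow) (i : Fin K) {m : ℕ} (hm : 1 ≤ m) :
    1 - B.tau i m ≤ (m : ℝ) ^ (-α) :=
  (le_abs_self _).trans (h.tail_upper i m hm)

lemma le_tail (h : B.TwoSidedTails α αlow c μlow) (i : Fin K) {m : ℕ} (hm : 1 ≤ m) :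
    c * (m : ℝ) ^ (-α) ≤ 1 - B.tau i m := by
  have := h.tail_lower i m hm
  rwa [abs_of_nonneg (by linarith [(B.tau_mem_Icc i m).2])] at this

lemma tail_le_min (h : B.TwoSidedTails α αlow c μlow) (i : Fin K) {m : ℕ} (hm : 1 ≤ m) :
    1 - B.tau i m ≤ (m : ℝ) ^ (-(min α (1 / 2))) :=
  (h.tail_le i hm).trans
    (Real.rpow_le_rpow_of_exponent_le (by exact_mod_cast hm) (by linarith [min_le_left α (1 / 2)]))

lemma α_pos (h : B.TwoSidedTails α αlow c μlow) : 0 < α := h.αlow_pos.trans_le h.αlow_le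

lemma one_le_base (h : B.TwoSidedTails α αlow c μlow) : 1 ≤ 2 / c := by
  rw [le_div_iff₀ h.c_pos]; linarith [h.c_le_one]

/-- At the ratio `(c / 2) ^ (1 / αlow)` between the two waiting times, the tail at the shorter one
is at least twice the upper bound for the tail at the longer one, so the difference of the tails
identifies `α`. -/
lemma rpow_neg_le_tau_sub_tau (h : B.TwoSidedTails α αlow c μlow) (i : Fin K) {d D : ℕ} (hd : 1 ≤ d)
    (hdD : (d : ℝ) ≤ (c / 2) ^ (1 / αlow) * D) : (D : ℝ) ^ (-α) ≤ B.tau i D - B.tau i d := by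
  have hc := h.c_pos
  have hd' : (1 : ℝ) ≤ d := by exact_mod_cast hd
  have hD : 1 ≤ D := by
    rcases Nat.eq_zero_or_pos D with rfl | hD
    · simp at hdD; omega
    · exact hD
  have hα := h.α_pos
  have hl := h.αlow_pos
  have h1 := h.tail_le i hD
  have h2 := h.le_tail i hd
  have h3 : ((c / 2) ^ (1 / αlow) * D) ^ (-α) ≤ (d : ℝ) ^ (-α) :=
    Real.rpow_le_rpow_of_nonpos (by linarith) hdD (by linarith)
  rw [Real.mul_rpow (by positivity) (by positivity), ← Real.rpow_mul (by positivity)] at h3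
  have h4 : 2 / c ≤ (c / 2) ^ (1 / αlow * -α) := by
    have h5 : 1 ≤ α / αlow := by rw [le_div_iff₀ hl]; linarith [h.αlow_le]
    have h6 := Real.rpow_le_rpow_of_exponent_ge (x := c / 2) (by positivity)
      (by linarith [h.c_le_one]) (show 1 / αlow * -α ≤ -1 by
        rw [show 1 / αlow * -α = -(α / αlow) by ring]; linarith)
    rw [Real.rpow_neg_one, inv_div] at h6
    exact h6
  have h7 : 0 ≤ (D : ℝ) ^ (-α) := by positivity
  have h8 : 2 / c * (D : ℝ) ^ (-α) ≤ (d : ℝ) ^ (-α) :=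
    (mul_le_mul_of_nonneg_right h4 h7).trans h3
  have h9 : c * (2 / c * (D : ℝ) ^ (-α)) ≤ c * (d : ℝ) ^ (-α) := mul_le_mul_of_nonneg_left h8 hc.le
  have h10 : c * (2 / c * (D : ℝ) ^ (-α)) = 2 * (D : ℝ) ^ (-α) := by field_simp
  linarith

end TwoSidedTails

end DelayedBandit

namespace AdaptPatientBandits

variable {K : ℕ}

/-! ### Consequences of concentration -/

/-- The logarithm that appears in the confidence widths. -/
noncomputable def confLog (K T : ℕ) : ℝ := Real.log (2 * (K : ℝ) * (T : ℝ) ^ 3)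

lemma one_le_confLog {T : ℕ} (hK : 1 ≤ K) (hT : 2 ≤ T) : 1 ≤ confLog K T := by
  have hK' : (1 : ℝ) ≤ K := by exact_mod_cast hK
  have hT' : (2 : ℝ) ≤ T := by exact_mod_cast hT
  have h8 : (2 : ℝ) ^ 3 ≤ (T : ℝ) ^ 3 := by gcongr
  rw [confLog, Real.le_log_iff_exp_le (by positivity)]
  nlinarith [Real.exp_one_lt_d9]

/-- The rules for how long to wait for the reward of round `s`, as seen from the end of round `N`:
either all of the elapsed time, as in `muHat`, or a fixed number `δ < T` of rounds, as in
`waitMean`. -/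
noncomputable def waitRules (T N : ℕ) : Finset (ℕ → ℕ) :=
  open Classical in insert (fun s => N - s) ((Finset.range T).image fun δ _ => δ)

lemma sub_mem_waitRules (T N : ℕ) : (fun s => N - s) ∈ waitRules T N := by simp [waitRules]

lemma const_mem_waitRules {T N δ : ℕ} (h : δ < T) : (fun _ => δ) ∈ waitRules T N := by
  classical
  exact Finset.mem_insert_of_mem (Finset.mem_image_of_mem _ (Finset.mem_range.2 h))

lemma card_waitRules_le (T N : ℕ) : (waitRules T N).card ≤ T + 1 := by
  classical
  refine (Finset.card_insert_le _ _).trans (Nat.succ_le_succ ?_)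
  simpa using Finset.card_image_le (s := Finset.range T) (f := fun δ (_ : ℕ) => δ)

/-- All the empirical sums used by the algorithm are within `√(2 confLog n)` of their compensators,
where `n` is the number of summands. -/
def Concentrated (B : DelayedBandit K) (T : ℕ) (I : ℕ → Fin K) (X : ℕ → ℕ → ℝ) : Prop :=
  ∀ i, ∀ N ∈ Finset.Icc 1 T, ∀ u ∈ waitRules T N,
    |∑ s ∈ Finset.Icc 1 N, (if I s = i then X s (u s) - B.mean i * B.tau i (u s) else 0)|
      ≤ Real.sqrt (2 * confLog K T * pulls I i N)

variable {B : DelayedBandit K} {T : ℕ} {I : ℕ → Fin K} {X : ℕ → ℕ → ℝ}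

lemma sqrt_mul_div_self (y : ℝ) {n : ℝ} (hn : 0 < n) : Real.sqrt (y * n) / n = Real.sqrt (y / n) := by
  have h : y * n = y / n * n ^ 2 := by field_simp
  rw [h, Real.sqrt_mul' _ (by positivity), Real.sqrt_sq hn.le]
  field_simp

lemma Concentrated.abs_muHat_sub_le (h : Concentrated B T I X) {t : ℕ} (ht : 1 ≤ t) (htT : t ≤ T)
    {i : Fin K} (hn : 1 ≤ pulls I i t) :
    |muHat I X i t - (1 / (pulls I i t : ℝ)) *
        ∑ s ∈ Finset.Icc 1 t, (if I s = i then B.mean i * B.tau i (t - s) else 0)|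
      ≤ Real.sqrt (2 * confLog K T / pulls I i t) := by
  have hn' : (0 : ℝ) < pulls I i t := by exact_mod_cast hn
  have h1 := h i t (Finset.mem_Icc.2 ⟨ht, htT⟩) _ (sub_mem_waitRules T t)
  rw [muHat, ← mul_sub, ← Finset.sum_sub_distrib, abs_mul, abs_of_nonneg (by positivity),
    one_div_mul_eq_div, ← sqrt_mul_div_self _ hn']
  gcongr
  refine (congrArg abs (Finset.sum_congr rfl fun s _ => ?_)).trans_le h1
  split_ifs <;> simp

lemma Concentrated.muHat_le (h : Concentrated B T I X) {t : ℕ} (ht : 1 ≤ t) (htT : t ≤ T)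
    {i : Fin K} (hn : 1 ≤ pulls I i t) :
    muHat I X i t ≤ B.mean i + Real.sqrt (2 * confLog K T / pulls I i t) := by
  have hn' : (0 : ℝ) < pulls I i t := by exact_mod_cast hn
  have h1 := (abs_le.1 (h.abs_muHat_sub_le ht htT hn)).2
  have h2 : ∑ s ∈ Finset.Icc 1 t, (if I s = i then B.mean i * B.tau i (t - s) else 0)
      ≤ pulls I i t * B.mean i := by
    rw [← sum_ite_const]
    refine Finset.sum_le_sum fun s _ => ?_
    split_ifs
    · exact mul_le_of_le_one_right (B.mean_mem_Icc i).1 (B.tau_mem_Icc i _).2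
    · exact le_rfl
  have h3 := mul_le_mul_of_nonneg_left h2 (show 0 ≤ 1 / (pulls I i t : ℝ) by positivity)
  have h4 : 1 / (pulls I i t : ℝ) * (pulls I i t * B.mean i) = B.mean i := by field_simp
  linarith

lemma Concentrated.le_muHat {α αlow c μlow : ℝ} (h : Concentrated B T I X)
    (hB : B.TwoSidedTails α αlow c μlow) {t : ℕ} (ht : 1 ≤ t) (htT : t ≤ T)
    {i : Fin K} (hn : 1 ≤ pulls I i t) :
    B.mean i - 2 * (pulls I i t : ℝ) ^ (-(min α (1 / 2)))
      - Real.sqrt (2 * confLog K T / pulls I i t) ≤ muHat I X i t := by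
  have hn' : (0 : ℝ) < pulls I i t := by exact_mod_cast hn
  have ha0 : 0 ≤ min α (1 / 2) := le_min hB.α_pos.le (by norm_num)
  have h1 := (abs_le.1 (h.abs_muHat_sub_le ht htT hn)).1
  have hm := B.mean_mem_Icc i
  have h2 := sum_tail_le ha0 (min_le_right _ _) (B.tail_antitone i)
    (by linarith [(B.tau_mem_Icc i 0).1]) (fun m hm => hB.tail_le_min i hm) I i hn
  have h3 : ∑ s ∈ Finset.Icc 1 t, (if I s = i then B.mean i * B.tau i (t - s) else 0)
      = pulls I i t * B.mean i - B.mean i *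
        ∑ s ∈ Finset.Icc 1 t, (if I s = i then 1 - B.tau i (t - s) else 0) := by
    rw [← sum_ite_const, Finset.mul_sum, ← Finset.sum_sub_distrib]
    refine Finset.sum_congr rfl fun s _ => ?_
    split_ifs <;> ring
  have h5 : (0 : ℝ) ≤ ∑ s ∈ Finset.Icc 1 t, (if I s = i then 1 - B.tau i (t - s) else 0) :=
    Finset.sum_nonneg fun s _ => by
      split_ifs
      · linarith [(B.tau_mem_Icc i (t - s)).2]
      · exact le_rfl
  have h4 : pulls I i t * B.mean i - 2 * (pulls I i t : ℝ) ^ (1 - min α (1 / 2)) ≤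
      ∑ s ∈ Finset.Icc 1 t, (if I s = i then B.mean i * B.tau i (t - s) else 0) := by
    rw [h3]; nlinarith [hm.1, hm.2]
  have h6 := mul_le_mul_of_nonneg_left h4 (show 0 ≤ 1 / (pulls I i t : ℝ) by positivity)
  have h7 : 1 / (pulls I i t : ℝ) *
      (pulls I i t * B.mean i - 2 * (pulls I i t : ℝ) ^ (1 - min α (1 / 2)))
      = B.mean i - 2 * (pulls I i t : ℝ) ^ (-(min α (1 / 2))) := by
    rw [sub_eq_add_neg 1, Real.rpow_add hn', Real.rpow_one]; field_simp
  linarith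

lemma Concentrated.abs_waitMean_sub_le (h : Concentrated B T I X) {t δ : ℕ} (htT : t ≤ T)
    {j : Fin K} (hn : 2 ≤ pulls I j t) (hδ : δ ≤ pulls I j t / 2) :
    |waitMean I X j t δ - B.mean j * B.tau j δ|
      ≤ 2 * Real.sqrt (confLog K T) * (pulls I j t : ℝ) ^ (-(1 / 2) : ℝ) := by
  have hL : 0 ≤ confLog K T := by
    have hp := pulls_le I j t
    have hK : 1 ≤ K := Fin.pos j
    exact zero_le_one.trans (one_le_confLog hK (by omega))
  have hp := pulls_le I j t
  have hq := pulls_le_pulls_sub_add I j t δ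
  set q := pulls I j (t - δ) with hq_def
  have hn' : (0 : ℝ) < pulls I j t := by exact_mod_cast (by omega : 0 < pulls I j t)
  have hq0 : (0 : ℝ) < q := by exact_mod_cast (by omega : 0 < q)
  have hq2 : (pulls I j t : ℝ) ≤ 2 * q := by exact_mod_cast (by omega : pulls I j t ≤ 2 * q)
  have h1 := h j (t - δ) (Finset.mem_Icc.2 ⟨by omega, by omega⟩) _
    (const_mem_waitRules (δ := δ) (by omega))
  have e1 : waitMean I X j t δ - B.mean j * B.tau j δ = (1 / (q : ℝ)) *
      ∑ s ∈ Finset.Icc 1 (t - δ), (if I s = j then X s δ - B.mean j * B.tau j δ else 0) := by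
    have e2 : ∑ s ∈ Finset.Icc 1 (t - δ), (if I s = j then X s δ - B.mean j * B.tau j δ else 0)
        = ∑ s ∈ Finset.Icc 1 (t - δ), (if I s = j then X s δ else 0)
          - q * (B.mean j * B.tau j δ) := by
      rw [hq_def, ← sum_ite_const, ← Finset.sum_sub_distrib]
      refine Finset.sum_congr rfl fun s _ => ?_
      split_ifs <;> ring
    rw [e2, waitMean, mul_sub, ← hq_def]
    field_simp
  rw [e1, abs_mul, abs_of_nonneg (by positivity), one_div_mul_eq_div]
  calc _ ≤ Real.sqrt (2 * confLog K T * q) / q := by gcongr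
    _ = Real.sqrt (2 * confLog K T / q) := sqrt_mul_div_self _ hq0
    _ ≤ Real.sqrt (2 ^ 2 * confLog K T / pulls I j t) := by
        apply Real.sqrt_le_sqrt
        rw [div_le_div_iff₀ hq0 hn']
        nlinarith
    _ = _ := by
        rw [Real.sqrt_div (by positivity), Real.sqrt_mul (by positivity),
          Real.sqrt_sq (by norm_num), Real.rpow_neg hn'.le, ← Real.sqrt_eq_rpow, div_eq_mul_inv]

/-! ### The estimated exponent -/

lemma rpow_log_div_log {x n : ℝ} (hn : 1 < n) (hx : 0 < x) : n ^ (Real.log x / Real.log n) = x := by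
  rw [Real.rpow_def_of_pos (by linarith), mul_div_cancel₀ _ (Real.log_pos hn).ne', Real.exp_log hx]

/-- The bonus `n ^ (-alphaBar)` expressed through the difference of the two waiting means; no
logarithms are left. -/
lemma rpow_neg_alphaBar (c αlow μlow : ℝ) (T : ℕ) (I : ℕ → Fin K) (X : ℕ → ℕ → ℝ) (j : Fin K)
    (t : ℕ) (hn : 1 < pulls I j t)
    (hR : 0 < 2 ^ 4 * Real.sqrt (confLog K T) / (c * μlow)) :
    (pulls I j t : ℝ) ^ (-(alphaBar c αlow μlow T I X j t)) =
      min (2 ^ 4 * Real.sqrt (confLog K T) / (c * μlow) *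
        max (waitMean I X j t (longWait I j t) - waitMean I X j t (shortWait c αlow I j t))
          ((pulls I j t : ℝ) ^ (-(1 / 2) : ℝ))) 1 := by
  have hn' : (1 : ℝ) < pulls I j t := by exact_mod_cast hn
  have hn0 : (0 : ℝ) < pulls I j t := by linarith
  have hmono := Real.monotone_rpow_of_base_ge_one hn'.le
  have h1 : (pulls I j t : ℝ) ^ (-(alphaHat c αlow I X j t)) =
      max (waitMean I X j t (longWait I j t) - waitMean I X j t (shortWait c αlow I j t))
          ((pulls I j t : ℝ) ^ (-(1 / 2) : ℝ)) := by
    unfold alphaHat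
    dsimp only
    split_ifs with hx
    · rw [max_eq_right]
      exact hx.trans (by positivity)
    · push Not at hx
      rw [← max_neg_neg, neg_neg, hmono.map_max, rpow_log_div_log hn' hx]
  have h2 := rpow_log_div_log hn' hR
  rw [alphaBar, ← confLog, ← min_neg_neg, hmono.map_min, neg_zero, Real.rpow_zero, neg_sub,
    sub_eq_add_neg, Real.rpow_add hn0, h1, h2]

end AdaptPatientBandits

namespace AdaptPatientBandits

variable {K : ℕ} {B : DelayedBandit K} {T : ℕ} {I : ℕ → Fin K} {X : ℕ → ℕ → ℝ}
  {α αlow c μlow : ℝ}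

lemma mul_μlow_lt_one (hB : B.TwoSidedTails α αlow c μlow) (j : Fin K) : c * μlow < 1 := by
  have h1 := hB.μlow_lt_mean j
  have h2 := (B.mean_mem_Icc j).2
  nlinarith [hB.c_pos, hB.c_le_one, hB.μlow_pos]

lemma Concentrated.abs_waitMean_sub_waitMean_le (h : Concentrated B T I X)
    (hB : B.TwoSidedTails α αlow c μlow) {t : ℕ} (htT : t ≤ T) {j : Fin K}
    (hn : 2 ≤ pulls I j t) :
    |(waitMean I X j t (longWait I j t) - waitMean I X j t (shortWait c αlow I j t))
      - B.mean j * (B.tau j (longWait I j t) - B.tau j (shortWait c αlow I j t))|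
      ≤ 4 * Real.sqrt (confLog K T) * (pulls I j t : ℝ) ^ (-(1 / 2) : ℝ) := by
  have hc := hB.c_pos
  have hd : shortWait c αlow I j t ≤ pulls I j t / 2 := by
    refine Nat.floor_le_of_le ?_
    refine mul_le_of_le_one_left (Nat.cast_nonneg _) (Real.rpow_le_one (by positivity)
      (by linarith [hB.c_le_one]) ?_)
    have := hB.αlow_pos
    positivity
  have h1 := abs_le.1 (h.abs_waitMean_sub_le htT hn (le_refl (pulls I j t / 2)))
  have h2 := abs_le.1 (h.abs_waitMean_sub_le htT hn hd)
  rw [longWait, abs_le]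
  constructor <;> linarith [h1.1, h1.2, h2.1, h2.2]

lemma shortWait_le (hB : B.TwoSidedTails α αlow c μlow) (I : ℕ → Fin K) (j : Fin K) (t : ℕ) :
    (shortWait c αlow I j t : ℝ) ≤ (c / 2) ^ (1 / αlow) * longWait I j t := by
  have := hB.c_pos
  exact Nat.floor_le (by positivity)

lemma rpow_inv_base (hB : B.TwoSidedTails α αlow c μlow) :
    (c / 2) ^ (1 / αlow) = ((2 / c) ^ (1 / αlow))⁻¹ := by
  have := hB.c_pos
  rw [← Real.inv_rpow (by positivity), inv_div]

/-- Once the shorter waiting time is positive, `alphaBar` is a lower bound for the exponent. -/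
lemma Concentrated.alphaBar_le (h : Concentrated B T I X) (hB : B.TwoSidedTails α αlow c μlow)
    (hT : 2 ≤ T) {t : ℕ} (htT : t ≤ T) {j : Fin K} (hn : 2 ≤ pulls I j t)
    (hd : 1 ≤ shortWait c αlow I j t) :
    alphaBar c αlow μlow T I X j t ≤ min α (1 / 2) := by
  have hn' : (1 : ℝ) < pulls I j t := by exact_mod_cast hn
  have hn0 : (0 : ℝ) < pulls I j t := by linarith
  have hc := hB.c_pos
  have hμ := hB.μlow_pos
  have hcμ : 0 < c * μlow := by positivity
  have hs : 1 ≤ Real.sqrt (confLog K T) := Real.one_le_sqrt.2 (one_le_confLog (Fin.pos j) hT)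
  have hR0 : 0 < 2 ^ 4 * Real.sqrt (confLog K T) / (c * μlow) := by positivity
  have hR1 : 1 ≤ 2 ^ 4 * Real.sqrt (confLog K T) / (c * μlow) := by
    rw [le_div_iff₀ hcμ]; linarith [mul_μlow_lt_one hB j]
  have hx := (abs_le.1 (h.abs_waitMean_sub_waitMean_le hB htT hn)).1
  have key := rpow_neg_alphaBar c αlow μlow T I X j t hn hR0
  have hgap := hB.rpow_neg_le_tau_sub_tau j hd (shortWait_le hB I j t)
  set x := waitMean I X j t (longWait I j t) - waitMean I X j t (shortWait c αlow I j t) with hxd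
  set s := Real.sqrt (confLog K T)
  set z := (pulls I j t : ℝ) ^ (-(1 / 2) : ℝ)
  have hz : 0 < z := by positivity
  have hM0 : 0 < max x z := lt_max_of_lt_right hz
  rw [← neg_le_neg_iff, ← Real.rpow_le_rpow_left_iff hn', key]
  refine le_min ?_ (Real.rpow_le_one_of_one_le_of_nonpos hn'.le
    (neg_nonpos.2 (le_min hB.α_pos.le (by norm_num))))
  rcases le_total (1 / 2) α with hα | hα
  · rw [min_eq_right hα]
    exact (le_max_right x z).trans (le_mul_of_one_le_left hM0.le hR1)
  · rw [min_eq_left hα]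
    have hD : 1 ≤ longWait I j t := by unfold longWait; omega
    have hD' : (1 : ℝ) ≤ longWait I j t := by exact_mod_cast hD
    have hDn : (longWait I j t : ℝ) ≤ pulls I j t := by
      exact_mod_cast Nat.div_le_self _ _
    have h1 : (pulls I j t : ℝ) ^ (-α) ≤ (longWait I j t : ℝ) ^ (-α) :=
      Real.rpow_le_rpow_of_nonpos (by linarith) hDn (by linarith [hB.α_pos])
    have hg0 : 0 ≤ (pulls I j t : ℝ) ^ (-α) := by positivity
    have h2 : μlow * (pulls I j t : ℝ) ^ (-α) ≤
        B.mean j * (B.tau j (longWait I j t) - B.tau j (shortWait c αlow I j t)) :=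
      mul_le_mul (hB.μlow_lt_mean j).le (h1.trans hgap) hg0 (B.mean_mem_Icc j).1
    have h3 : x + 4 * s * z ≤ 5 * s * max x z := by
      have a1 : x ≤ s * max x z := (le_max_left x z).trans (le_mul_of_one_le_left hM0.le hs)
      have a2 : s * z ≤ s * max x z := mul_le_mul_of_nonneg_left (le_max_right x z) (by linarith)
      linarith
    have h4 : μlow * (pulls I j t : ℝ) ^ (-α) ≤ 5 * s * max x z := by linarith
    rw [div_mul_eq_mul_div, le_div_iff₀ hcμ]
    have h5 : 0 ≤ s * max x z := by positivity
    calc (pulls I j t : ℝ) ^ (-α) * (c * μlow) = c * (μlow * (pulls I j t : ℝ) ^ (-α)) := by ring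
      _ ≤ c * (5 * s * max x z) := mul_le_mul_of_nonneg_left h4 hc.le
      _ ≤ 1 * (5 * s * max x z) := mul_le_mul_of_nonneg_right hB.c_le_one (by linarith)
      _ ≤ 2 ^ 4 * s * max x z := by linarith

/-- Once the shorter waiting time is positive, the bonus computed with `alphaBar` exceeds the one
computed with the true exponent by at most a factor. -/
lemma Concentrated.rpow_neg_alphaBar_le (h : Concentrated B T I X)
    (hB : B.TwoSidedTails α αlow c μlow) (hT : 2 ≤ T) {t : ℕ} (htT : t ≤ T) {j : Fin K}
    (hn : 2 ≤ pulls I j t) (hd : 1 ≤ shortWait c αlow I j t) :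
    (pulls I j t : ℝ) ^ (-(alphaBar c αlow μlow T I X j t)) ≤
      112 * confLog K T * (2 / c) ^ (min α (1 / 2) / αlow) / (c * μlow)
        * (pulls I j t : ℝ) ^ (-(min α (1 / 2))) := by
  have hn' : (1 : ℝ) < pulls I j t := by exact_mod_cast hn
  have hn0 : (0 : ℝ) < pulls I j t := by linarith
  have hc := hB.c_pos
  have hμ := hB.μlow_pos
  have hl := hB.αlow_pos
  have hcμ : 0 < c * μlow := by positivity
  have hL := one_le_confLog (Fin.pos j) hT
  have hs : 1 ≤ Real.sqrt (confLog K T) := Real.one_le_sqrt.2 hL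
  have hss : Real.sqrt (confLog K T) * Real.sqrt (confLog K T) = confLog K T :=
    Real.mul_self_sqrt (by linarith)
  have hR0 : 0 < 2 ^ 4 * Real.sqrt (confLog K T) / (c * μlow) := by positivity
  have hx := (abs_le.1 (h.abs_waitMean_sub_waitMean_le hB htT hn)).2
  rw [rpow_neg_alphaBar c αlow μlow T I X j t hn hR0]
  refine (min_le_left _ _).trans ?_
  have ha0 : 0 ≤ min α (1 / 2) := le_min hB.α_pos.le (by norm_num)
  have ha1 : min α (1 / 2) ≤ 1 / 2 := min_le_right _ _
  have htail := hB.tail_le_min j hd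
  set a := min α (1 / 2)
  set x := waitMean I X j t (longWait I j t) - waitMean I X j t (shortWait c αlow I j t) with hxd
  set s := Real.sqrt (confLog K T)
  set z := (pulls I j t : ℝ) ^ (-(1 / 2) : ℝ)
  set g := (pulls I j t : ℝ) ^ (-a)
  set b := (2 / c) ^ (1 / αlow) with hb
  have hb1 : 1 ≤ b := Real.one_le_rpow hB.one_le_base (by positivity)
  have hβ : b ^ a = (2 / c) ^ (a / αlow) := by
    rw [hb, ← Real.rpow_mul (by positivity)]; congr 1; ring
  have hβ1 : 1 ≤ b ^ a := Real.one_le_rpow hb1 ha0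
  have hz : 0 < z := by positivity
  have hg : 0 < g := by positivity
  have hzg : z ≤ g := Real.rpow_le_rpow_of_exponent_le hn'.le (by linarith)
  -- the waiting time lost to the two roundings is at most a factor `6`
  have hdn : (pulls I j t : ℝ) / (6 * b) ≤ shortWait c αlow I j t := by
    have h1 : (pulls I j t : ℝ) ≤ 3 * longWait I j t := by
      unfold longWait
      exact_mod_cast (by omega : pulls I j t ≤ 3 * (pulls I j t / 2))
    have h2 := Nat.lt_floor_add_one ((c / 2) ^ (1 / αlow) * (longWait I j t : ℝ))
    rw [← shortWait, rpow_inv_base hB, ← hb, inv_mul_eq_div, div_lt_iff₀ (by linarith)] at h2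
    have h3 : (1 : ℝ) ≤ shortWait c αlow I j t := by exact_mod_cast hd
    rw [div_le_iff₀ (by linarith)]
    nlinarith
  have hdg : (shortWait c αlow I j t : ℝ) ^ (-a) ≤ 3 * b ^ a * g := by
    have h1 := Real.rpow_le_rpow_of_nonpos (by positivity) hdn (neg_nonpos.2 ha0)
    have h6 : (6 : ℝ) ^ a ≤ 3 := by
      calc (6 : ℝ) ^ a ≤ 6 ^ (1 / 2 : ℝ) := Real.rpow_le_rpow_of_exponent_le (by norm_num) ha1
        _ = Real.sqrt 6 := (Real.sqrt_eq_rpow 6).symm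
        _ ≤ 3 := Real.sqrt_le_iff.2 ⟨by norm_num, by norm_num⟩
    have e : ((pulls I j t : ℝ) / (6 * b)) ^ (-a) = 6 ^ a * b ^ a * g := by
      rw [Real.div_rpow hn0.le (by positivity), Real.rpow_neg (x := 6 * b) (by positivity),
        div_inv_eq_mul, Real.mul_rpow (by norm_num) (by linarith)]
      ring
    rw [e] at h1
    have h7 : 6 ^ a * (b ^ a * g) ≤ 3 * (b ^ a * g) :=
      mul_le_mul_of_nonneg_right h6 (by positivity)
    linarith
  have hM : max x z ≤ 7 * s * b ^ a * g := by
    have h1 : B.mean j * (B.tau j (longWait I j t) - B.tau j (shortWait c αlow I j t))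
        ≤ 3 * b ^ a * g := by
      refine le_trans ?_ (htail.trans hdg)
      have := B.mean_mem_Icc j
      have h2 := B.tau_mem_Icc j (longWait I j t)
      have h3 := B.tau_mem_Icc j (shortWait c αlow I j t)
      nlinarith [this.1, this.2, h2.1, h2.2, h3.1, h3.2]
    have p1 : g ≤ b ^ a * g := le_mul_of_one_le_left hg.le hβ1
    have p2 : b ^ a * g ≤ s * (b ^ a * g) := le_mul_of_one_le_left (by positivity) hs
    have p3 : s * z ≤ s * (b ^ a * g) := mul_le_mul_of_nonneg_left (hzg.trans p1) (by linarith)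
    refine max_le ?_ ?_
    · linarith
    · linarith
  rw [← hβ]
  calc 2 ^ 4 * s / (c * μlow) * max x z ≤ 2 ^ 4 * s / (c * μlow) * (7 * s * b ^ a * g) :=
        mul_le_mul_of_nonneg_left hM hR0.le
    _ = 112 * (s * s) * b ^ a / (c * μlow) * g := by ring
    _ = _ := by rw [hss]

/-! ### Regret on the concentration event -/

/-- The regret of one round `t + 1`. While the shorter waiting time is still zero nothing is known
about `alphaBar`, but then every arm has been pulled so rarely that the bound exceeds `1`. -/
lemma Concentrated.mean_sub_mean_le (h : Concentrated B T I X)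
    (hB : B.TwoSidedTails α αlow c μlow) (hT : 2 ≤ T) {t : ℕ} (htT : t < T)
    (hp : ∀ i, 2 ≤ pulls I i t) {j : Fin K} (hj : ∀ i, pulls I i t ≤ pulls I j t)
    (hucb : ∀ i, ucb T I X (alphaBar c αlow μlow T I X j t) i t
        ≤ ucb T I X (alphaBar c αlow μlow T I X j t) (I (t + 1)) t) (i : Fin K) :
    B.mean i - B.mean (I (t + 1)) ≤
      256 * confLog K T * (2 / c) ^ (min α (1 / 2) / αlow) / (c * μlow)
        * (pulls I (I (t + 1)) t : ℝ) ^ (-(min α (1 / 2))) := by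
  have hc := hB.c_pos
  have hμ := hB.μlow_pos
  have hl := hB.αlow_pos
  have hcμ : 0 < c * μlow := by positivity
  have hcμ1 := mul_μlow_lt_one hB j
  have hL := one_le_confLog (Fin.pos j) hT
  have ha0 : 0 ≤ min α (1 / 2) := le_min hB.α_pos.le (by norm_num)
  have ha1 : min α (1 / 2) ≤ 1 / 2 := min_le_right _ _
  have hβ1 : 1 ≤ (2 / c) ^ (min α (1 / 2) / αlow) :=
    Real.one_le_rpow hB.one_le_base (by positivity)
  have hfac : confLog K T * (2 / c) ^ (min α (1 / 2) / αlow)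
      ≤ confLog K T * (2 / c) ^ (min α (1 / 2) / αlow) / (c * μlow) := by
    rw [le_div_iff₀ hcμ]
    exact mul_le_of_le_one_right (by positivity) hcμ1.le
  have hLβ : confLog K T ≤ confLog K T * (2 / c) ^ (min α (1 / 2) / αlow) :=
    le_mul_of_one_le_right (by linarith) hβ1
  have hβL : (2 / c) ^ (min α (1 / 2) / αlow)
      ≤ confLog K T * (2 / c) ^ (min α (1 / 2) / αlow) :=
    le_mul_of_one_le_left (by linarith) hL
  set k := I (t + 1)
  have hk := hp k
  have hk' : (1 : ℝ) < pulls I k t := by exact_mod_cast hk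
  have hk0 : (0 : ℝ) < pulls I k t := by linarith
  have hkj : (pulls I k t : ℝ) ≤ pulls I j t := by exact_mod_cast hj k
  have ht : 1 ≤ t := by have := pulls_le I k t; omega
  have hg : 0 < (pulls I k t : ℝ) ^ (-(min α (1 / 2))) := by positivity
  rcases Nat.eq_zero_or_pos (shortWait c αlow I j t) with hd | hd
  -- here the most pulled arm, hence also arm `k`, has at most `3 (2 / c) ^ (1 / αlow)` pulls
  · set a := min α (1 / 2)
    set b := (2 / c) ^ (1 / αlow) with hb
    have hb1 : 1 ≤ b := Real.one_le_rpow hB.one_le_base (by positivity)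
    have hβ : b ^ a = (2 / c) ^ (a / αlow) := by
      rw [hb, ← Real.rpow_mul (by positivity)]; congr 1; ring
    have hn : (pulls I k t : ℝ) ≤ 3 * b := by
      rw [shortWait, Nat.floor_eq_zero, rpow_inv_base hB, ← hb, inv_mul_eq_div,
        div_lt_one (by linarith)] at hd
      have h1 : (pulls I j t : ℝ) ≤ 2 * longWait I j t + 1 := by
        unfold longWait
        exact_mod_cast (by omega : pulls I j t ≤ 2 * (pulls I j t / 2) + 1)
      linarith
    have h1 : (3 * b) ^ (-a) ≤ (pulls I k t : ℝ) ^ (-a) :=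
      Real.rpow_le_rpow_of_nonpos hk0 hn (neg_nonpos.2 ha0)
    have h3 : (3 : ℝ) ^ a ≤ 3 := by
      simpa using Real.rpow_le_rpow_of_exponent_le (x := 3) (by norm_num)
        (show a ≤ 1 by linarith)
    have h4 : 1 ≤ 3 * b ^ a * (pulls I k t : ℝ) ^ (-a) := by
      calc (1 : ℝ) = (3 * b) ^ a * (3 * b) ^ (-a) := by
            rw [← Real.rpow_add (by positivity), add_neg_cancel, Real.rpow_zero]
        _ ≤ (3 * b) ^ a * (pulls I k t : ℝ) ^ (-a) := by gcongr
        _ = 3 ^ a * b ^ a * (pulls I k t : ℝ) ^ (-a) := by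
            rw [Real.mul_rpow (by norm_num) (by linarith)]
        _ ≤ _ := by gcongr
    rw [hβ] at h4
    have h5 : 3 * (2 / c) ^ (a / αlow)
        ≤ 256 * confLog K T * (2 / c) ^ (a / αlow) / (c * μlow) := by
      rw [mul_assoc 256, mul_div_assoc 256]
      linarith
    have h6 := mul_le_mul_of_nonneg_right h5 hg.le
    linarith [(B.mean_mem_Icc i).2, (B.mean_mem_Icc k).1]
  · have hαle := h.alphaBar_le hB hT htT.le (hp j) hd
    have hpow := h.rpow_neg_alphaBar_le hB hT htT.le (hp j) hd
    have hu := hucb i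
    unfold ucb at hu
    rw [min_eq_left (hαle.trans ha1)] at hu
    have hi := h.le_muHat hB ht htT.le (i := i) (by have := hp i; omega)
    have hk2 := h.muHat_le ht htT.le (i := k) (by omega)
    set a := min α (1 / 2)
    set ab := alphaBar c αlow μlow T I X j t
    rw [← confLog] at hu
    have hi' : (1 : ℝ) ≤ pulls I i t := by
      have := hp i
      exact_mod_cast (by omega : 1 ≤ pulls I i t)
    -- the bonus of arm `i` covers the rewards that are still missing from its estimator
    have h1 : (pulls I i t : ℝ) ^ (-a) ≤ (pulls I i t : ℝ) ^ (-ab) :=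
      Real.rpow_le_rpow_of_exponent_le hi' (by linarith)
    -- the comparison for the most pulled arm carries over to less pulled arms
    have h2 : (pulls I k t : ℝ) ^ (-ab) ≤
        112 * confLog K T * (2 / c) ^ (a / αlow) / (c * μlow) * (pulls I k t : ℝ) ^ (-a) := by
      have e : ∀ n : ℝ, 0 < n → n ^ (-ab) = n ^ (a - ab) * n ^ (-a) := fun n hn => by
        rw [← Real.rpow_add hn]; congr 1; ring
      have hj0 : (0 : ℝ) < pulls I j t := by linarith
      rw [e _ hj0] at hpow
      have h3 := le_of_mul_le_mul_right hpow (Real.rpow_pos_of_pos hj0 _)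
      rw [e _ hk0]
      refine mul_le_mul_of_nonneg_right (le_trans ?_ h3) hg.le
      exact Real.rpow_le_rpow hk0.le hkj (by linarith)
    have h3 : Real.sqrt (2 * confLog K T / pulls I k t)
        ≤ 2 * confLog K T * (pulls I k t : ℝ) ^ (-a) := by
      have e : (pulls I k t : ℝ) ^ (-(1 / 2) : ℝ) ≤ (pulls I k t : ℝ) ^ (-a) :=
        Real.rpow_le_rpow_of_exponent_le hk'.le (by linarith)
      rw [Real.sqrt_div (by linarith), Real.sqrt_eq_rpow (pulls I k t : ℝ), div_eq_mul_inv,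
        ← Real.rpow_neg hk0.le]
      refine mul_le_mul ?_ e (by positivity) (by linarith)
      exact Real.sqrt_le_iff.2 ⟨by linarith, by nlinarith⟩
    have h4 : confLog K T * (pulls I k t : ℝ) ^ (-a) ≤
        confLog K T * (2 / c) ^ (a / αlow) / (c * μlow) * (pulls I k t : ℝ) ^ (-a) :=
      mul_le_mul_of_nonneg_right (hLβ.trans hfac) hg.le
    have e1 : 112 * confLog K T * (2 / c) ^ (a / αlow) / (c * μlow) * (pulls I k t : ℝ) ^ (-a)
        = 112 * (confLog K T * (2 / c) ^ (a / αlow) / (c * μlow) * (pulls I k t : ℝ) ^ (-a)) := by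
      ring
    have e2 : 256 * confLog K T * (2 / c) ^ (a / αlow) / (c * μlow) * (pulls I k t : ℝ) ^ (-a)
        = 256 * (confLog K T * (2 / c) ^ (a / αlow) / (c * μlow) * (pulls I k t : ℝ) ^ (-a)) := by
      ring
    rw [e1] at h2
    rw [e2]
    have h5 : 0 ≤ confLog K T * (2 / c) ^ (a / αlow) / (c * μlow) * (pulls I k t : ℝ) ^ (-a) := by
      positivity
    linarith

lemma natCast_le_rpow_mul_rpow {a : ℝ} (ha : a ≤ 1) {K T : ℕ} (hK : 1 ≤ K) (hKT : K ≤ T) :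
    (K : ℝ) ≤ (K : ℝ) ^ a * (T : ℝ) ^ (1 - a) := by
  have hK' : (0 : ℝ) < K := by exact_mod_cast hK
  have h1 : (K : ℝ) ^ (1 - a) ≤ (T : ℝ) ^ (1 - a) :=
    Real.rpow_le_rpow hK'.le (by exact_mod_cast hKT) (by linarith)
  calc (K : ℝ) = (K : ℝ) ^ a * (K : ℝ) ^ (1 - a) := by
        rw [← Real.rpow_add hK']; simp
    _ ≤ _ := mul_le_mul_of_nonneg_left h1 (by positivity)

/-- The pseudo-regret on the concentration event. The first `2 K` rounds cost at most `1` each,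
which is of the order of the bound because `K ≤ T`. -/
lemma Concentrated.sum_gap_le (h : Concentrated B T I X) (hB : B.TwoSidedTails α αlow c μlow)
    (hK : 1 ≤ K) (hKT : K < T) (hF : Follows c αlow μlow T I X) :
    ∑ t ∈ Finset.Icc 1 T, ((⨆ i, B.mean i) - B.mean (I t)) ≤
      1026 * confLog K T * (2 / c) ^ (min α (1 / 2) / αlow) / (c * μlow)
        * ((K : ℝ) ^ min α (1 / 2) * (T : ℝ) ^ (1 - min α (1 / 2))) := by
  have : Nonempty (Fin K) := ⟨⟨0, hK⟩⟩
  have hc := hB.c_pos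
  have hμ := hB.μlow_pos
  have hl := hB.αlow_pos
  have hT : 2 ≤ T := by omega
  have hcμ : 0 < c * μlow := by positivity
  have hcμ1 := mul_μlow_lt_one hB ⟨0, hK⟩
  have hL := one_le_confLog hK hT
  have ha0 : 0 ≤ min α (1 / 2) := le_min hB.α_pos.le (by norm_num)
  have ha1 : min α (1 / 2) ≤ 1 / 2 := min_le_right _ _
  have hβ1 : 1 ≤ (2 / c) ^ (min α (1 / 2) / αlow) :=
    Real.one_le_rpow hB.one_le_base (by positivity)
  have hW1 : 1 ≤ confLog K T * (2 / c) ^ (min α (1 / 2) / αlow) / (c * μlow) := by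
    rw [le_div_iff₀ hcμ]; nlinarith
  have hgap : ∀ i, (⨆ i, B.mean i) - B.mean i ≤ 1 := fun i => by
    have h1 : (⨆ i, B.mean i) ≤ 1 := ciSup_le fun i => (B.mean_mem_Icc i).2
    linarith [(B.mean_mem_Icc i).1]
  have hKb := natCast_le_rpow_mul_rpow (a := min α (1 / 2)) (by linarith) hK hKT.le
  set a := min α (1 / 2)
  set W := confLog K T * (2 / c) ^ (a / αlow) / (c * μlow) with hW
  set V := (K : ℝ) ^ a * (T : ℝ) ^ (1 - a)
  have hV : 0 < V := lt_of_lt_of_le (by exact_mod_cast hK) hKb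
  have e1 : 1026 * confLog K T * (2 / c) ^ (a / αlow) / (c * μlow) = 1026 * W := by rw [hW]; ring
  have e2 : 256 * confLog K T * (2 / c) ^ (a / αlow) / (c * μlow) = 256 * W := by rw [hW]; ring
  rw [e1]
  have hVW : V ≤ W * V := le_mul_of_one_le_left hV.le hW1
  have hshift : ∑ t ∈ Finset.Icc 1 T, ((⨆ i, B.mean i) - B.mean (I t))
      = ∑ t ∈ Finset.Ico 0 T, ((⨆ i, B.mean i) - B.mean (I (t + 1))) := by
    rw [Finset.sum_Ico_add' (fun t => (⨆ i, B.mean i) - B.mean (I t)) 0 T 1]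
    rfl
  have htriv : ∀ m n : ℕ, m ≤ n → ∑ t ∈ Finset.Ico m n, ((⨆ i, B.mean i) - B.mean (I (t + 1)))
      ≤ (n : ℝ) - m := fun m n hmn => by
    have := Finset.sum_le_card_nsmul (Finset.Ico m n) _ 1 fun t _ => hgap (I (t + 1))
    simpa [Nat.cast_sub hmn] using this
  rw [hshift]
  rcases lt_or_ge T (2 * K) with h2 | h2
  · have h3 := htriv 0 T (by omega)
    have h4 : (T : ℝ) ≤ 2 * K := by exact_mod_cast h2.le
    simp only [Nat.cast_zero, sub_zero] at h3
    nlinarith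
  · rw [← Finset.sum_Ico_consecutive _ (Nat.zero_le (2 * K)) h2]
    have h3 := htriv 0 (2 * K) (by omega)
    push_cast at h3
    have hp : ∀ t, 2 * K ≤ t → ∀ i, 2 ≤ pulls I i t := fun t ht i =>
      (hF.1 h2 i).ge.trans (pulls_mono I i ht)
    have h4 : ∑ t ∈ Finset.Ico (2 * K) T, ((⨆ i, B.mean i) - B.mean (I (t + 1)))
        ≤ ∑ t ∈ Finset.Ico (2 * K) T, 256 * W * (pulls I (I (t + 1)) t : ℝ) ^ (-a) := by
      refine Finset.sum_le_sum fun t ht => ?_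
      rw [Finset.mem_Ico] at ht
      obtain ⟨j, hj, hu⟩ := hF.2.2 t ht.1 ht.2
      rw [sub_le_iff_le_add]
      refine ciSup_le fun i => ?_
      have := h.mean_sub_mean_le hB hT ht.2 (hp t ht.1) hj hu i
      rw [e2] at this
      linarith
    rw [← Finset.mul_sum] at h4
    have h5 := sum_pulls_rpow_neg_le ha0 ha1 I h2
      (fun i => le_trans (by norm_num) (hp (2 * K) le_rfl i))
    have h6 := sum_pulls_rpow_le ha0 (by linarith) hK I T
    have h7 : 256 * W * ∑ t ∈ Finset.Ico (2 * K) T, (pulls I (I (t + 1)) t : ℝ) ^ (-a)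
        ≤ 256 * W * (4 * V) := mul_le_mul_of_nonneg_left (by linarith) (by positivity)
    linarith

end AdaptPatientBandits

/-! ### Expectations along a run -/

namespace DelayedBandit

variable {K : ℕ} {B : DelayedBandit K}

/-- The joint law of the reward and the delay of a pull of arm `i`. -/
noncomputable def pullLaw (B : DelayedBandit K) (i : Fin K) : Measure (ℝ × ℕ) := (B.reward i).prod (B.delay i)

instance (B : DelayedBandit K) (i : Fin K) : IsProbabilityMeasure (B.pullLaw i) := by
  have := B.reward_prob i
  have := B.delay_prob i
  unfold pullLaw
  infer_instance

lemma ae_pullLaw (B : DelayedBandit K) (i : Fin K) :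
    ∀ᵐ z ∂(B.pullLaw i), z.1 ∈ Set.Icc (0 : ℝ) 1 := by
  have := B.reward_prob i
  have := B.delay_prob i
  exact Measure.quasiMeasurePreserving_fst.ae (B.reward_support i)

lemma integral_fst_pullLaw (B : DelayedBandit K) (i : Fin K) :
    ∫ z, z.1 ∂(B.pullLaw i) = B.mean i := by
  have := B.reward_prob i
  have := B.delay_prob i
  rw [pullLaw, integral_fun_fst (μ := B.reward i) (ν := B.delay i) (fun x => x)]
  simp [mean]

lemma integral_observed (B : DelayedBandit K) (i : Fin K) (w : ℕ) :
    ∫ z, (if z.2 ≤ w then z.1 else 0) ∂(B.pullLaw i) = B.mean i * B.tau i w := by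
  have := B.reward_prob i
  have := B.delay_prob i
  have h := integral_prod_mul (μ := B.reward i) (ν := B.delay i) (fun x : ℝ => x)
    ((Set.Iic w).indicator (1 : ℕ → ℝ))
  rw [integral_indicator_one measurableSet_Iic] at h
  rw [mean, tau, ← h, pullLaw]
  refine integral_congr_ae (Filter.Eventually.of_forall fun z => ?_)
  by_cases hz : z.2 ≤ w <;> simp [hz, Set.indicator]

lemma measurable_observed (w : ℕ) :
    Measurable fun z : ℝ × ℕ => if z.2 ≤ w then z.1 else 0 :=
  Measurable.ite (measurableSet_le measurable_snd measurable_const) measurable_fst measurable_const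

/-- Hoeffding's lemma for the observed reward of one pull. -/
lemma lintegral_exp_observed_le (B : DelayedBandit K) (i : Fin K) (w : ℕ) (l : ℝ) :
    ∫⁻ z, ENNReal.ofReal (Real.exp (l * ((if z.2 ≤ w then z.1 else 0) - B.mean i * B.tau i w)
      - l ^ 2 / 8)) ∂(B.pullLaw i) ≤ 1 := by
  have hb : ∀ᵐ z ∂(B.pullLaw i), (if z.2 ≤ w then z.1 else 0) ∈ Set.Icc (0 : ℝ) 1 := by
    filter_upwards [B.ae_pullLaw i] with z hz
    split_ifs
    · exact hz
    · simp
  have h := hasSubgaussianMGF_of_mem_Icc (measurable_observed w).aemeasurable hb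
  rw [integral_observed] at h
  have h1 := h.mgf_le l
  have h2 := h.integrable_exp_mul l
  have e : ∀ z : ℝ × ℕ, Real.exp (l * ((if z.2 ≤ w then z.1 else 0) - B.mean i * B.tau i w)
      - l ^ 2 / 8) = Real.exp (-(l ^ 2 / 8)) *
        Real.exp (l * ((if z.2 ≤ w then z.1 else 0) - B.mean i * B.tau i w)) := fun z => by
    rw [← Real.exp_add]; congr 1; ring
  simp_rw [e]
  rw [← ofReal_integral_eq_lintegral_ofReal (h2.const_mul _)
    (Filter.Eventually.of_forall fun z => by positivity), integral_const_mul]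
  rw [ENNReal.ofReal_le_one]
  calc _ ≤ Real.exp (-(l ^ 2 / 8)) * Real.exp (((‖(1 : ℝ) - 0‖₊ / 2) ^ 2 : NNReal) * l ^ 2 / 2) :=
        mul_le_mul_of_nonneg_left h1 (Real.exp_pos _).le
    _ = 1 := by
        rw [← Real.exp_add, Real.exp_eq_one_iff]
        simp; ring

namespace IsRun

variable {Ω : Type*} [mΩ : MeasurableSpace Ω] {P : Measure Ω} {T : ℕ}
  {ℱ : Filtration ℕ mΩ} {I : ℕ → Ω → Fin K} {C : ℕ → Ω → ℝ} {D : ℕ → Ω → ℕ}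

lemma measurableSet_arm (h : B.IsRun P T ℱ I C D) {t : ℕ} (ht : t < T) (i : Fin K) :
    MeasurableSet[ℱ t] {ω | I (t + 1) ω = i} :=
  h.measurable_arm t ht (measurableSet_singleton i)

lemma measurable_pair (h : B.IsRun P T ℱ I C D) {t : ℕ} (ht : t < T) :
    Measurable[ℱ (t + 1)] fun ω => (C (t + 1) ω, D (t + 1) ω) :=
  Measurable.prodMk (h.measurable_reward t ht) (h.measurable_delay t ht)

lemma map_restrict_eq (h : B.IsRun P T ℱ I C D) {t : ℕ} (ht : t < T) (i : Fin K) {A : Set Ω}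
    (hA : MeasurableSet[ℱ t] A) :
    (P.restrict (A ∩ {ω | I (t + 1) ω = i})).map (fun ω => (C (t + 1) ω, D (t + 1) ω))
      = P (A ∩ {ω | I (t + 1) ω = i}) • B.pullLaw i := by
  have hm := (h.measurable_pair ht).mono (ℱ.le (t + 1)) le_rfl
  ext S hS
  rw [Measure.map_apply hm hS, Measure.restrict_apply (hm hS), Measure.smul_apply, smul_eq_mul,
    pullLaw, ← h.law t ht i A hA S hS, Set.inter_comm]
  rfl

/-- On the event that arm `i` is pulled, its reward and delay are independent of the past. -/
lemma setLIntegral_mul (h : B.IsRun P T ℱ I C D) {t : ℕ} (ht : t < T) (i : Fin K)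
    {Y : Ω → ENNReal} (hY : Measurable[ℱ t] Y) {f : ℝ × ℕ → ENNReal} (hf : Measurable f) :
    ∫⁻ ω in {ω | I (t + 1) ω = i}, f (C (t + 1) ω, D (t + 1) ω) * Y ω ∂P
      = (∫⁻ z, f z ∂(B.pullLaw i)) * ∫⁻ ω in {ω | I (t + 1) ω = i}, Y ω ∂P := by
  have hm := (h.measurable_pair ht).mono (ℱ.le (t + 1)) le_rfl
  have hfm := hf.comp hm
  have hYm := hY.mono (ℱ.le t) le_rfl
  set E := {ω | I (t + 1) ω = i}
  have hE : MeasurableSet[ℱ t] E := h.measurableSet_arm ht i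
  set Q := (P.restrict E).withDensity (f ∘ fun ω => (C (t + 1) ω, D (t + 1) ω)) with hQ
  have htrim : Q.trim (ℱ.le t) = (∫⁻ z, f z ∂(B.pullLaw i)) • (P.restrict E).trim (ℱ.le t) := by
    refine @Measure.ext _ (ℱ t) _ _ fun A hA => ?_
    rw [Measure.smul_apply, trim_measurableSet_eq _ hA, trim_measurableSet_eq _ hA,
      hQ, withDensity_apply _ (ℱ.le t _ hA), Measure.restrict_apply (ℱ.le t _ hA),
      Measure.restrict_restrict (ℱ.le t _ hA)]
    have e := lintegral_map (μ := P.restrict (A ∩ E)) hf hm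
    rw [h.map_restrict_eq ht i hA, lintegral_smul_measure] at e
    rw [smul_eq_mul, mul_comm]
    exact e.symm
  have e1 : ∫⁻ ω, Y ω ∂Q = ∫⁻ ω in E, f (C (t + 1) ω, D (t + 1) ω) * Y ω ∂P := by
    rw [hQ, lintegral_withDensity_eq_lintegral_mul _ hfm hYm]
    rfl
  rw [← e1, ← lintegral_trim (ℱ.le t) hY, htrim, lintegral_smul_measure,
    lintegral_trim (ℱ.le t) hY, smul_eq_mul]

lemma ae_reward_mem_Icc (h : B.IsRun P T ℱ I C D) {t : ℕ} (ht : t < T) :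
    ∀ᵐ ω ∂P, C (t + 1) ω ∈ Set.Icc (0 : ℝ) 1 := by
  have hm := (h.measurable_pair ht).mono (ℱ.le (t + 1)) le_rfl
  have key : ∀ i, ∀ᵐ ω ∂P, I (t + 1) ω = i → C (t + 1) ω ∈ Set.Icc (0 : ℝ) 1 := fun i => by
    have hE := ℱ.le t _ (h.measurableSet_arm ht i)
    have h1 := h.map_restrict_eq ht i MeasurableSet.univ
    rw [Set.univ_inter] at h1
    have h2 : ∀ᵐ z ∂((P.restrict {ω | I (t + 1) ω = i}).map
        fun ω => (C (t + 1) ω, D (t + 1) ω)), z.1 ∈ Set.Icc (0 : ℝ) 1 := by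
      rw [h1]
      exact Measure.ae_smul_measure (B.ae_pullLaw i) _
    exact (ae_restrict_iff' hE).1 (ae_of_ae_map hm.aemeasurable h2)
  filter_upwards [ae_all_iff.2 key] with ω hω using hω _ rfl

variable [IsProbabilityMeasure P]

lemma integrable_reward (h : B.IsRun P T ℱ I C D) {t : ℕ} (ht : t < T) :
    Integrable (C (t + 1)) P :=
  Integrable.of_mem_Icc 0 1
    ((h.measurable_reward t ht).mono (ℱ.le (t + 1)) le_rfl).aemeasurable (h.ae_reward_mem_Icc ht)

lemma integrable_mean_arm (h : B.IsRun P T ℱ I C D) {t : ℕ} (ht : t < T) :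
    Integrable (fun ω => B.mean (I (t + 1) ω)) P :=
  Integrable.of_mem_Icc 0 1
    ((measurable_of_finite B.mean).comp ((h.measurable_arm t ht).mono (ℱ.le t) le_rfl)).aemeasurable
    (Filter.Eventually.of_forall fun _ => B.mean_mem_Icc _)

lemma integral_reward (h : B.IsRun P T ℱ I C D) {t : ℕ} (ht : t < T) :
    ∫ ω, C (t + 1) ω ∂P = ∫ ω, B.mean (I (t + 1) ω) ∂P := by
  have hm := (h.measurable_pair ht).mono (ℱ.le (t + 1)) le_rfl
  have hE := fun i => ℱ.le t _ (h.measurableSet_arm ht i)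
  have split : ∀ f : Ω → ℝ, Integrable f P →
      ∫ ω, f ω ∂P = ∑ i, ∫ ω in {ω | I (t + 1) ω = i}, f ω ∂P := fun f hf => by
    rw [← integral_iUnion_fintype hE (fun i j hij => Set.disjoint_left.2 fun _ hi hj =>
      hij (hi.symm.trans hj)) (fun i => hf.integrableOn)]
    rw [show (⋃ i, {ω | I (t + 1) ω = i}) = Set.univ by ext ω; simp, setIntegral_univ]
  rw [split _ (h.integrable_reward ht), split _ (h.integrable_mean_arm ht)]
  refine Finset.sum_congr rfl fun i _ => ?_
  have h1 := h.map_restrict_eq ht i MeasurableSet.univ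
  rw [Set.univ_inter] at h1
  have h2 := integral_map (μ := P.restrict {ω | I (t + 1) ω = i}) hm.aemeasurable
    (f := fun z => z.1) measurable_fst.aestronglyMeasurable
  rw [h1, integral_smul_measure, integral_fst_pullLaw] at h2
  rw [← h2, setIntegral_congr_fun (g := fun _ => B.mean i) (hE i) (fun ω hω =>
    congrArg B.mean (show I (t + 1) ω = i from hω))]
  simp [Measure.real]

/-- The regret is the expected sum of the gaps of the pulled arms. -/
lemma regret_eq (h : B.IsRun P T ℱ I C D) :
    B.regret P T C = ∫ ω, ∑ t ∈ Finset.Icc 1 T, ((⨆ i, B.mean i) - B.mean (I t ω)) ∂P := by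
  have pred : ∀ t ∈ Finset.Icc 1 T, ∃ s, s < T ∧ t = s + 1 := fun t ht => by
    rw [Finset.mem_Icc] at ht
    exact ⟨t - 1, by omega, by omega⟩
  have i1 : ∀ t ∈ Finset.Icc 1 T, Integrable (C t) P := fun t ht => by
    obtain ⟨s, hs, rfl⟩ := pred t ht
    exact h.integrable_reward hs
  have i2 : ∀ t ∈ Finset.Icc 1 T, Integrable (fun ω => B.mean (I t ω)) P := fun t ht => by
    obtain ⟨s, hs, rfl⟩ := pred t ht
    exact h.integrable_mean_arm hs
  rw [regret, integral_finsetSum _ i1,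
    integral_finsetSum (f := fun t ω => (⨆ i, B.mean i) - B.mean (I t ω)) _
      (fun t ht => (integrable_const _).sub (i2 t ht))]
  have : ∀ t ∈ Finset.Icc 1 T, ∫ ω, ((⨆ i, B.mean i) - B.mean (I t ω)) ∂P
      = (⨆ i, B.mean i) - ∫ ω, C t ω ∂P := fun t ht => by
    rw [integral_sub (integrable_const _) (i2 t ht)]
    obtain ⟨s, hs, rfl⟩ := pred t ht
    rw [h.integral_reward hs]
    simp
  rw [Finset.sum_congr rfl this, Finset.sum_sub_distrib]
  simp

end IsRun
end DelayedBandit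

/-! ### Concentration -/

namespace AdaptPatientBandits

variable {K : ℕ} {B : DelayedBandit K}

/-- The sum over the pulls of arm `i` up to round `N` of the rewards that are observed within
`u s` rounds, minus its compensator. -/
noncomputable def deviation (B : DelayedBandit K) (u : ℕ → ℕ) (i : Fin K) (I : ℕ → Fin K) (X : ℕ → ℕ → ℝ)
    (N : ℕ) : ℝ :=
  ∑ s ∈ Finset.Icc 1 N, (if I s = i then X s (u s) - B.mean i * B.tau i (u s) else 0)

lemma deviation_succ (u : ℕ → ℕ) (i : Fin K) (I : ℕ → Fin K) (X : ℕ → ℕ → ℝ) (N : ℕ) :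
    deviation B u i I X (N + 1) = deviation B u i I X N +
      if I (N + 1) = i then X (N + 1) (u (N + 1)) - B.mean i * B.tau i (u (N + 1)) else 0 :=
  Finset.sum_Icc_succ_top (by omega) _

variable {Ω : Type*} {I : ℕ → Ω → Fin K} {C : ℕ → Ω → ℝ} {D : ℕ → Ω → ℕ}

/-- The exponential supermartingale of `deviation`, with the sub-Gaussian compensator
`l ^ 2 / 8` for every pull of the arm. -/
noncomputable def expDeviation (B : DelayedBandit K) (I : ℕ → Ω → Fin K) (C : ℕ → Ω → ℝ) (D : ℕ → Ω → ℕ)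
    (u : ℕ → ℕ) (i : Fin K) (l : ℝ) (N : ℕ) (ω : Ω) : ENNReal :=
  ENNReal.ofReal (Real.exp (l * deviation B u i (fun t => I t ω)
    (observedReward (fun t => C t ω) (fun t => D t ω)) N
      - l ^ 2 / 8 * pulls (fun t => I t ω) i N))

lemma expDeviation_succ_of_eq (u : ℕ → ℕ) (i : Fin K) (l : ℝ) (N : ℕ) {ω : Ω}
    (h : I (N + 1) ω = i) :
    expDeviation B I C D u i l (N + 1) ω =
      (fun z : ℝ × ℕ => ENNReal.ofReal (Real.exp (l * ((if z.2 ≤ u (N + 1) then z.1 else 0)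
        - B.mean i * B.tau i (u (N + 1))) - l ^ 2 / 8))) (C (N + 1) ω, D (N + 1) ω)
        * expDeviation B I C D u i l N ω := by
  simp only [expDeviation]
  rw [← ENNReal.ofReal_mul (Real.exp_pos _).le, ← Real.exp_add, deviation_succ, pulls_succ,
    if_pos h, if_pos h]
  congr 2
  simp only [observedReward]
  push_cast
  ring

lemma expDeviation_succ_of_ne (u : ℕ → ℕ) (i : Fin K) (l : ℝ) (N : ℕ) {ω : Ω}
    (h : I (N + 1) ω ≠ i) :
    expDeviation B I C D u i l (N + 1) ω = expDeviation B I C D u i l N ω := by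
  simp only [expDeviation]
  rw [deviation_succ, pulls_succ, if_neg h, if_neg h, add_zero, add_zero]

variable [mΩ : MeasurableSpace Ω] {P : Measure Ω} {T : ℕ} {ℱ : Filtration ℕ mΩ}

lemma measurable_expDeviation (h : B.IsRun P T ℱ I C D) (u : ℕ → ℕ) (i : Fin K) (l : ℝ) {N : ℕ}
    (hN : N ≤ T) : Measurable[ℱ N] (expDeviation B I C D u i l N) := by
  classical
  induction N with
  | zero =>
    have e : expDeviation B I C D u i l 0 = fun _ => 1 := by
      ext ω; simp [expDeviation, deviation, pulls_zero]
    rw [e]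
    exact measurable_const
  | succ N ih =>
    have h1 := (ih (by omega)).mono (ℱ.mono (Nat.le_succ N)) le_rfl
    have hE := ℱ.mono (Nat.le_succ N) _ (h.measurableSet_arm hN i)
    have hf : Measurable fun z : ℝ × ℕ => ENNReal.ofReal (Real.exp
        (l * ((if z.2 ≤ u (N + 1) then z.1 else 0) - B.mean i * B.tau i (u (N + 1)))
          - l ^ 2 / 8)) := by
      have := DelayedBandit.measurable_observed (u (N + 1))
      fun_prop
    have h2 := (hf.comp (h.measurable_pair hN)).mul h1
    have e : expDeviation B I C D u i l (N + 1) = fun ω =>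
        if I (N + 1) ω = i then (((fun z : ℝ × ℕ => ENNReal.ofReal (Real.exp
          (l * ((if z.2 ≤ u (N + 1) then z.1 else 0) - B.mean i * B.tau i (u (N + 1)))
          - l ^ 2 / 8))) ∘ fun ω => (C (N + 1) ω, D (N + 1) ω)) * expDeviation B I C D u i l N) ω
        else expDeviation B I C D u i l N ω := by
      ext ω
      split_ifs with hi
      · exact expDeviation_succ_of_eq u i l N hi
      · exact expDeviation_succ_of_ne u i l N hi
    rw [e]
    exact Measurable.ite hE h2 h1

lemma lintegral_expDeviation_le_one [IsProbabilityMeasure P] (h : B.IsRun P T ℱ I C D)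
    (u : ℕ → ℕ) (i : Fin K) (l : ℝ) {N : ℕ} (hN : N ≤ T) :
    ∫⁻ ω, expDeviation B I C D u i l N ω ∂P ≤ 1 := by
  induction N with
  | zero => simp [expDeviation, deviation, pulls_zero]
  | succ N ih =>
    refine le_trans ?_ (ih (by omega))
    have hE := ℱ.le N _ (h.measurableSet_arm hN i)
    rw [← lintegral_add_compl _ hE, ← lintegral_add_compl (expDeviation B I C D u i l N) hE]
    refine add_le_add ?_ ?_
    · rw [setLIntegral_congr_fun hE fun ω hω => expDeviation_succ_of_eq u i l N hω]
      have hf : Measurable fun z : ℝ × ℕ => ENNReal.ofReal (Real.exp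
          (l * ((if z.2 ≤ u (N + 1) then z.1 else 0) - B.mean i * B.tau i (u (N + 1)))
            - l ^ 2 / 8)) := by
        have := DelayedBandit.measurable_observed (u (N + 1))
        fun_prop
      rw [h.setLIntegral_mul hN i (measurable_expDeviation h u i l (by omega)) hf]
      exact mul_le_of_le_one_left zero_le (B.lintegral_exp_observed_le i _ l)
    · rw [setLIntegral_congr_fun hE.compl fun ω hω => expDeviation_succ_of_ne u i l N hω]

/-- The Chernoff bound for a fixed number `n` of pulls. The number of pulls is random, and fixing
it makes the compensator of `expDeviation` deterministic. -/
lemma measure_lt_mul_deviation_le [IsProbabilityMeasure P] (h : B.IsRun P T ℱ I C D)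
    (u : ℕ → ℕ) (i : Fin K) {N n : ℕ} (hN : N ≤ T) (hn : 1 ≤ n) {y σ : ℝ} (hy : 0 ≤ y)
    (hσ : σ ^ 2 = 1) :
    P {ω | pulls (fun t => I t ω) i N = n ∧ Real.sqrt (2 * y * n) < σ *
      deviation B u i (fun t => I t ω) (observedReward (fun t => C t ω) (fun t => D t ω)) N}
      ≤ ENNReal.ofReal (Real.exp (-(4 * y))) := by
  have hn0 : (0 : ℝ) < n := by exact_mod_cast hn
  set ε := Real.sqrt (2 * y * n) with hε
  have hεε : ε ^ 2 = 2 * y * n := Real.sq_sqrt (by positivity)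
  have hε0 : 0 ≤ ε := Real.sqrt_nonneg _
  -- the minimiser of `l ^ 2 / 8 * n - |l| * ε`; the sign `σ` selects the tail
  set l := σ * (4 * ε / n) with hl
  have hl2 : l ^ 2 / 8 * n = 4 * y := by
    rw [hl, mul_pow, hσ, div_pow, mul_pow, hεε]; field_simp; ring
  have hmarkov := mul_meas_ge_le_lintegral₀ (μ := P)
    ((measurable_expDeviation h u i l hN).mono (ℱ.le N) le_rfl).aemeasurable
    (ENNReal.ofReal (Real.exp (4 * y)))
  have h1 := hmarkov.trans (lintegral_expDeviation_le_one h u i l hN)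
  have hsub : {ω | pulls (fun t => I t ω) i N = n ∧ ε < σ *
      deviation B u i (fun t => I t ω) (observedReward (fun t => C t ω) (fun t => D t ω)) N}
      ⊆ {ω | ENNReal.ofReal (Real.exp (4 * y)) ≤ expDeviation B I C D u i l N ω} := by
    rintro ω ⟨hω1, hω2⟩
    refine ENNReal.ofReal_le_ofReal (Real.exp_le_exp.2 ?_)
    rw [hω1, hl2]
    have h3 : 4 * ε / n * ε ≤ 4 * ε / n * (σ * deviation B u i (fun t => I t ω)
        (observedReward (fun t => C t ω) (fun t => D t ω)) N) :=
      mul_le_mul_of_nonneg_left hω2.le (by positivity)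
    have h4 : 4 * ε / n * ε = 8 * y := by
      rw [div_mul_eq_mul_div, mul_assoc, ← sq, hεε]; field_simp; ring
    rw [hl]
    linarith
  refine (measure_mono hsub).trans ?_
  rw [Real.exp_neg, ENNReal.ofReal_inv_of_pos (Real.exp_pos _), ENNReal.le_inv_iff_mul_le,
    mul_comm]
  exact h1

/-- Union bound over the arm, the round, the waiting rule, the number of pulls and the sign. -/
lemma measure_not_concentrated_le [IsProbabilityMeasure P] (h : B.IsRun P T ℱ I C D)
    (hK : 1 ≤ K) (hT : 2 ≤ T) :
    P {ω | ¬ Concentrated B T (fun t => I t ω)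
        (observedReward (fun t => C t ω) (fun t => D t ω))}
      ≤ ENNReal.ofReal (K * T * (T + 1) * T * 2 * Real.exp (-(4 * confLog K T))) := by
  have hL : 0 ≤ confLog K T := zero_le_one.trans (one_le_confLog hK hT)
  set bad : Fin K → ℕ → (ℕ → ℕ) → ℕ → ℝ → Set Ω := fun i N u n σ =>
    {ω | pulls (fun t => I t ω) i N = n ∧ Real.sqrt (2 * confLog K T * n) < σ *
      deviation B u i (fun t => I t ω) (observedReward (fun t => C t ω) (fun t => D t ω)) N}
    with hbad
  have hsub : {ω | ¬ Concentrated B T (fun t => I t ω)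
        (observedReward (fun t => C t ω) (fun t => D t ω))}
      ⊆ ⋃ i ∈ (Finset.univ : Finset (Fin K)), ⋃ N ∈ Finset.Icc 1 T, ⋃ u ∈ waitRules T N,
        ⋃ n ∈ Finset.Icc 1 T, ⋃ σ ∈ ({1, -1} : Finset ℝ), bad i N u n σ := by
    intro ω hω
    simp only [Set.mem_ofPred_eq, Concentrated, not_forall, not_le, exists_prop] at hω
    obtain ⟨i, N, hN, u, hu, hlt⟩ := hω
    have hn : 1 ≤ pulls (fun t => I t ω) i N := by
      by_contra h0
      have h0' : pulls (fun t => I t ω) i N = 0 := by omega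
      have hne : ∀ s ∈ Finset.Icc 1 N, ¬ I s ω = i := by
        simpa [pulls, Finset.filter_eq_empty_iff] using h0'
      rw [Finset.sum_eq_zero fun s hs => if_neg (hne s hs), abs_zero] at hlt
      exact absurd hlt (not_lt.2 (Real.sqrt_nonneg _))
    have hnT : pulls (fun t => I t ω) i N ≤ T :=
      (pulls_le _ i N).trans (Finset.mem_Icc.1 hN).2
    simp only [Set.mem_iUnion, exists_prop]
    refine ⟨i, Finset.mem_univ i, N, hN, u, hu, _, Finset.mem_Icc.2 ⟨hn, hnT⟩, ?_⟩
    rcases lt_abs.1 hlt with h1 | h1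
    · exact ⟨1, by simp, rfl, by rwa [one_mul]⟩
    · exact ⟨-1, by simp, rfl, by rwa [neg_one_mul]⟩
  set p := ENNReal.ofReal (Real.exp (-(4 * confLog K T)))
  have hp : ∀ i, ∀ N ∈ Finset.Icc 1 T, ∀ u, ∀ n ∈ Finset.Icc 1 T, ∀ σ ∈ ({1, -1} : Finset ℝ),
      P (bad i N u n σ) ≤ p := fun i N hN u n hn σ hσ =>
    measure_lt_mul_deviation_le h u i (Finset.mem_Icc.1 hN).2 (Finset.mem_Icc.1 hn).1 hL
      (by rcases Finset.mem_insert.1 hσ with rfl | h1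
          · norm_num
          · rw [Finset.mem_singleton.1 h1]; norm_num)
  have step : ∀ {ι : Type} (s : Finset ι) (A : ι → Set Ω) (m : ℕ) (q : ENNReal), s.card ≤ m →
      (∀ x ∈ s, P (A x) ≤ q) → P (⋃ x ∈ s, A x) ≤ m * q := fun s A m q hm hA =>
    (measure_biUnion_finset_le s A).trans <| (Finset.sum_le_card_nsmul s _ q hA).trans <| by
      rw [nsmul_eq_mul]; gcongr
  have hcard : ({1, -1} : Finset ℝ).card ≤ 2 := Finset.card_le_two
  refine (measure_mono hsub).trans ?_
  refine (step _ _ K ((T : ℕ) * (((T + 1 : ℕ)) * ((T : ℕ) * ((2 : ℕ) * p)))) (by simp)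
    fun i _ => step _ _ T _ (by simp) fun N hN => step _ _ (T + 1) _ (card_waitRules_le T N)
    fun u _ => step _ _ T _ (by simp) fun n hn => step _ _ 2 _ hcard
    fun σ hσ => hp i N hN u n hn σ hσ).trans ?_
  rw [ENNReal.ofReal_mul (by positivity)]
  refine le_of_eq ?_
  have e : ENNReal.ofReal ((K : ℝ) * T * (T + 1) * T * 2) = K * T * ((T + 1 : ℕ)) * T * (2 : ℕ) := by
    rw [show (K : ℝ) * T * (T + 1) * T * 2 = ((K * T * (T + 1) * T * 2 : ℕ) : ℝ) by push_cast; ring,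
      ENNReal.ofReal_natCast]
    push_cast; ring
  rw [e]; ring

/-- The failure probability is small enough that it costs at most one unit of regret. -/
lemma mul_failure_le_one {T : ℕ} (hK : 1 ≤ K) (hT : 2 ≤ T) :
    (T : ℝ) * (K * T * (T + 1) * T * 2 * Real.exp (-(4 * confLog K T))) ≤ 1 := by
  have hK' : (1 : ℝ) ≤ K := by exact_mod_cast hK
  have hT' : (2 : ℝ) ≤ T := by exact_mod_cast hT
  have hpos : 0 < 2 * (K : ℝ) * (T : ℝ) ^ 3 := by positivity
  have e : Real.exp (-(4 * confLog K T)) = ((2 * (K : ℝ) * (T : ℝ) ^ 3) ^ 4)⁻¹ := by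
    rw [Real.exp_neg, confLog, mul_comm, Real.exp_mul, Real.exp_log hpos]
    norm_cast
  rw [e, ← mul_assoc, ← div_eq_mul_inv, div_le_one (by positivity)]
  have hT3 : 1 ≤ (T : ℝ) ^ 3 := one_le_pow₀ (by linarith)
  have hone : 1 ≤ 2 * (K : ℝ) * (T : ℝ) ^ 3 := by nlinarith
  calc (T : ℝ) * (K * T * (T + 1) * T * 2) ≤ T * (K * T * (2 * T) * T * 2) := by
        gcongr; linarith
    _ = (2 * T) * (2 * K * T ^ 3) * 1 := by ring
    _ ≤ (2 * T) * (2 * K * T ^ 3) * (K * T ^ 2) := by gcongr; nlinarith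
    _ = (2 * (K : ℝ) * (T : ℝ) ^ 3) ^ 2 := by ring
    _ ≤ _ := pow_le_pow_right₀ hone (by norm_num)

end AdaptPatientBandits

/-! ### The regret bound -/

open AdaptPatientBandits in
/-- The regret bound before the constants are rounded up. The summand `1` pays for the failure of
concentration. -/
lemma DelayedBandit.IsRun.regret_le {K T : ℕ} (hK : 1 ≤ K) (hKT : K < T)
    {α αlow c μlow : ℝ} {B : DelayedBandit K} (hB : B.TwoSidedTails α αlow c μlow)
    {Ω : Type*} [mΩ : MeasurableSpace Ω] {P : Measure Ω} [IsProbabilityMeasure P]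
    {ℱ : Filtration ℕ mΩ} {I : ℕ → Ω → Fin K} {C : ℕ → Ω → ℝ} {D : ℕ → Ω → ℕ}
    (hrun : B.IsRun P T ℱ I C D)
    (halg : ∀ᵐ ω ∂P, Follows c αlow μlow T (fun t => I t ω)
      (observedReward (fun t => C t ω) (fun t => D t ω))) :
    B.regret P T C ≤ 1026 * confLog K T * (2 / c) ^ (min α (1 / 2) / αlow) / (c * μlow)
        * ((K : ℝ) ^ min α (1 / 2) * (T : ℝ) ^ (1 - min α (1 / 2))) + 1 := by
  have hT : 2 ≤ T := by omega
  have hL := one_le_confLog hK hT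
  have hc := hB.c_pos
  have hμ := hB.μlow_pos
  have : Nonempty (Fin K) := ⟨⟨0, hK⟩⟩
  set bad := {ω | ¬ Concentrated B T (fun t => I t ω)
        (observedReward (fun t => C t ω) (fun t => D t ω))} with hbad
  have hP := measure_not_concentrated_le hrun hK hT
  set W := 1026 * confLog K T * (2 / c) ^ (min α (1 / 2) / αlow) / (c * μlow)
        * ((K : ℝ) ^ min α (1 / 2) * (T : ℝ) ^ (1 - min α (1 / 2))) with hW
  have hW0 : 0 ≤ W := by positivity
  have hfail : (T : ℝ) * P.real (toMeasurable P bad) ≤ 1 := by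
    refine le_trans ?_ (mul_failure_le_one hK hT)
    refine mul_le_mul_of_nonneg_left ?_ (Nat.cast_nonneg _)
    rw [Measure.real, measure_toMeasurable]
    exact ENNReal.toReal_le_of_le_ofReal (by positivity) hP
  have hm : MeasurableSet (toMeasurable P bad) := measurableSet_toMeasurable P bad
  have hint : Integrable (fun ω => W + (toMeasurable P bad).indicator (fun _ => (T : ℝ)) ω) P :=
    (integrable_const _).add ((integrable_const _).indicator hm)
  rw [hrun.regret_eq]
  calc ∫ ω, ∑ t ∈ Finset.Icc 1 T, ((⨆ i, B.mean i) - B.mean (I t ω)) ∂P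
      ≤ ∫ ω, (W + (toMeasurable P bad).indicator (fun _ => (T : ℝ)) ω) ∂P := by
        refine integral_mono_of_nonneg (Filter.Eventually.of_forall fun ω => ?_) hint ?_
        · exact Finset.sum_nonneg fun t _ => sub_nonneg.2
            (le_ciSup (Set.finite_range B.mean).bddAbove (I t ω))
        · filter_upwards [halg] with ω hω
          by_cases hb : ω ∈ bad
          · rw [Set.indicator_of_mem (subset_toMeasurable P bad hb)]
            have h1 : ∀ t ∈ Finset.Icc 1 T, (⨆ i, B.mean i) - B.mean (I t ω) ≤ 1 := fun t _ => by
              have h2 : (⨆ i, B.mean i) ≤ 1 := ciSup_le fun i => (B.mean_mem_Icc i).2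
              linarith [(B.mean_mem_Icc (I t ω)).1]
            have h3 := Finset.sum_le_card_nsmul _ _ _ h1
            simp only [Nat.card_Icc, add_tsub_cancel_right, nsmul_eq_mul, mul_one] at h3
            linarith
          · have hconc : Concentrated B T (fun t => I t ω)
                (observedReward (fun t => C t ω) (fun t => D t ω)) := by
              simpa [hbad] using hb
            have h1 := hconc.sum_gap_le hB hK hKT hω
            have h2 : 0 ≤ (toMeasurable P bad).indicator (fun _ => (T : ℝ)) ω :=
              Set.indicator_nonneg (fun _ _ => Nat.cast_nonneg _) _
            linarith
    _ = W + P.real (toMeasurable P bad) * T := by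
        rw [integral_add (integrable_const _) ((integrable_const _).indicator hm),
          integral_indicator_const _ hm]
        simp
    _ ≤ W + 1 := by linarith

lemma AdaptPatientBandits.confLog_le {K T : ℕ} (hK : 1 ≤ K) (hKT : K < T) :
    AdaptPatientBandits.confLog K T ≤ 4 * Real.log (2 * (T : ℝ)) := by
  have hK' : (1 : ℝ) ≤ K := by exact_mod_cast hK
  have hKT' : (K : ℝ) ≤ T := by exact_mod_cast hKT.le
  have e : 4 * Real.log (2 * (T : ℝ)) = Real.log ((2 * (T : ℝ)) ^ 4) := by
    rw [Real.log_pow]; norm_num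
  rw [confLog, e]
  have hT0 : (0 : ℝ) < T := by linarith
  refine Real.log_le_log (by positivity) ?_
  have h3 : (0 : ℝ) ≤ (T : ℝ) ^ 3 := by positivity
  calc 2 * (K : ℝ) * (T : ℝ) ^ 3 ≤ 2 * T * T ^ 3 := by gcongr
    _ ≤ (2 * (T : ℝ)) ^ 4 := by nlinarith

theorem theorem6 (K T : ℕ) (hK : 1 ≤ K) (hKT : K < T)
    (α αlow c μlow : ℝ) (B : DelayedBandit K) (hB : B.TwoSidedTails α αlow c μlow)
    {Ω : Type*} [mΩ : MeasurableSpace Ω] (P : Measure Ω) [IsProbabilityMeasure P]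
    (ℱ : Filtration ℕ mΩ) (I : ℕ → Ω → Fin K) (C : ℕ → Ω → ℝ) (D : ℕ → Ω → ℕ)
    (hrun : B.IsRun P T ℱ I C D)
    (halg : ∀ᵐ ω ∂P, AdaptPatientBandits.Follows c αlow μlow T (fun t => I t ω)
      (observedReward (fun t => C t ω) (fun t => D t ω))) :
    B.regret P T C
        ≤ 8 ^ 17 * (1 / (c * μlow)) ^ 4 * (2 / c) ^ (4 * min α (1 / 2) / αlow)
          * Real.log (2 * (T : ℝ)) ^ ((13 : ℝ) / 2)
          * ((T : ℝ) * ((K : ℝ) / (T : ℝ)) ^ min α (1 / 2)) ∧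
      B.regret P T C
        ≤ 8 ^ 17 * (1 / (c * μlow)) ^ 4 * (2 / c) ^ (4 * min α (1 / 2) / αlow)
          * Real.log (2 * (T : ℝ)) ^ ((13 : ℝ) / 2)
          * ((K : ℝ) ^ α * (T : ℝ) ^ (1 - min α (1 / 2))) := by
  have hc := hB.c_pos
  have hμ := hB.μlow_pos
  have hl := hB.αlow_pos
  have hcμ : 0 < c * μlow := by positivity
  have hcμ1 := AdaptPatientBandits.mul_μlow_lt_one hB ⟨0, hK⟩
  have hK' : (1 : ℝ) ≤ K := by exact_mod_cast hK
  have hT' : (2 : ℝ) ≤ T := by exact_mod_cast (by omega : 2 ≤ T)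
  have hT0 : (0 : ℝ) < T := by linarith
  have ha0 : 0 ≤ min α (1 / 2) := le_min hB.α_pos.le (by norm_num)
  have haα : min α (1 / 2) ≤ α := min_le_left _ _
  have ha1 : min α (1 / 2) ≤ 1 / 2 := min_le_right _ _
  have hreg := hrun.regret_le hK hKT hB halg
  have hL := AdaptPatientBandits.confLog_le hK hKT
  have hKV := AdaptPatientBandits.natCast_le_rpow_mul_rpow (a := min α (1 / 2)) (by linarith)
    hK hKT.le
  set a := min α (1 / 2)
  set ℓ := Real.log (2 * (T : ℝ)) with hℓd
  have hℓ : 1 ≤ ℓ := by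
    rw [hℓd, Real.le_log_iff_exp_le (by linarith)]
    linarith [Real.exp_one_lt_d9]
  set β := (2 / c) ^ (a / αlow) with hβd
  set r := 1 / (c * μlow) with hr
  have hr1 : 1 ≤ r := by rw [hr, le_div_iff₀ hcμ]; linarith
  have hβ1 : 1 ≤ β := Real.one_le_rpow hB.one_le_base (by positivity)
  have hβ4 : (2 / c) ^ (4 * a / αlow) = β ^ 4 := by
    rw [hβd, ← Real.rpow_natCast, ← Real.rpow_mul (by positivity)]
    congr 1; push_cast; ring
  have hV1 : 1 ≤ (K : ℝ) ^ a * (T : ℝ) ^ (1 - a) := hK'.trans hKV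
  have e1 : (T : ℝ) * ((K : ℝ) / (T : ℝ)) ^ a = (K : ℝ) ^ a * (T : ℝ) ^ (1 - a) := by
    rw [Real.div_rpow (by linarith) hT0.le, sub_eq_add_neg, Real.rpow_add hT0, Real.rpow_one,
      Real.rpow_neg hT0.le]
    ring
  have h2 : (K : ℝ) ^ a * (T : ℝ) ^ (1 - a) ≤ (K : ℝ) ^ α * (T : ℝ) ^ (1 - a) := by
    have := Real.rpow_le_rpow_of_exponent_le hK' haα
    gcongr
  set V := (K : ℝ) ^ a * (T : ℝ) ^ (1 - a)
  have hr4 : r ≤ r ^ 4 := le_self_pow₀ hr1 (by norm_num)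
  have hβ4' : β ≤ β ^ 4 := le_self_pow₀ hβ1 (by norm_num)
  have hℓ' : ℓ ≤ ℓ ^ ((13 : ℝ) / 2) := by
    simpa using Real.rpow_le_rpow_of_exponent_le hℓ (show (1 : ℝ) ≤ 13 / 2 by norm_num)
  have hmain : B.regret P T C ≤ 8 ^ 17 * r ^ 4 * β ^ 4 * ℓ ^ ((13 : ℝ) / 2) * V := by
    have e2 : 1026 * AdaptPatientBandits.confLog K T * β / (c * μlow) * V
        = 1026 * (AdaptPatientBandits.confLog K T * (β * r * V)) := by rw [hr]; ring
    have hq : 1 ≤ r * β * ℓ * V := by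
      have := one_le_mul_of_one_le_of_one_le (one_le_mul_of_one_le_of_one_le
        (one_le_mul_of_one_le_of_one_le hr1 hβ1) hℓ) hV1
      exact this
    have h3 : AdaptPatientBandits.confLog K T * (β * r * V) ≤ 4 * ℓ * (β * r * V) :=
      mul_le_mul_of_nonneg_right hL (by positivity)
    have h4 : B.regret P T C ≤ 8 ^ 17 * (r * β * ℓ * V) := by
      have e3 : 4 * ℓ * (β * r * V) = 4 * (r * β * ℓ * V) := by ring
      linarith
    calc B.regret P T C ≤ 8 ^ 17 * (r * β * ℓ * V) := h4
      _ = 8 ^ 17 * r * β * ℓ * V := by ring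
      _ ≤ _ := by gcongr
  rw [e1, hβ4]
  refine ⟨hmain, hmain.trans ?_⟩
  exact mul_le_mul_of_nonneg_left h2 (by positivity)
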